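/- Throughout, $\langle g\rangle_J=\frac1{|J|}\int_J g$, and $Q$ is either a bounded nondegenerate interval or $Q=\mathbb R$; $J$ ranges over the bounded nondegenerate subintervals of $Q$. "Locally integrable" means integrable on each such $J$. For $p\in[1,2]$ let $$\|\varphi\|_{{\rm BMO}^p(Q)}=\sup_{J\subset Q}\big\langle|\varphi-\langle\varphi\rangle_J|^p\big\rangle_J^{1/p},$$ and let ${\rm BMO}(Q)$ be the set of locally integrable real functions $\varphi$ on $Q$ for which this is finite (the set does not depend on $p$). An almost everywhere positive function $w$ belongs to $A_\infty(Q)$ if $w$ and $\log w$ are locally integrable and $\sup_{J\subset Q}\langle w\rangle_J e^{-\langle\log w\rangle_J}<\infty$. For $\varphi\in{\rm BMO}(Q)$ let $\varepsilon_\varphi=\sup\{\varepsilon>0:\ e^{\varepsilon\varphi}\in A_\infty(Q)\}\in(0,\infty]$. Let $\varepsilon_0(p)$ be the John--Nirenberg constant of ${\rm BMO}^p((0,1))$, that is, the largest number $\varepsilon_0$ such that for each $0\le\varepsilon<\varepsilon_0$ there is a finite constant $C(\varepsilon,p)$ with $\langle e^\varphi\rangle_J\le C(\varepsilon,p)\,e^{\langle\varphi\rangle_J}$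 for all $\varphi\in{\rm BMO}((0,1))$ with $\|\varphi\|_{{\rm BMO}^p((0,1))}\le\varepsilon$ and all subintervals $J$ of $(0,1)$. Let $p\in[1,2]$. If $Q$ is a bounded interval and $\varphi\in{\rm BMO}(Q)$, then $$\inf_{f\in L^\infty(Q)}\|\varphi-f\|_{{\rm BMO}^p(Q)}\ \ge\ \frac{\varepsilon_0(p)}{\min\{\varepsilon_\varphi,\varepsilon_{-\varphi}\}},\qquad(1)$$ where the right-hand side is $0$ if $\varepsilon_\varphi=\varepsilon_{-\varphi}=\infty$. If $\varphi\in{\rm BMO}(\mathbb R)$, then, with $\varepsilon_{\pm\varphi}$ taken with respect to $A_\infty(\mathbb R)$, $$\inf_{f\in L^\infty(\mathbb R)}\|\varphi-f\|_{{\rm BMO}^p(\mathbb R)}\ \ge\ \frac{\varepsilon_0(p)}{\min\{\varepsilon_\varphi,\varepsilon_{-\varphi}\}}.$$ Inequality (1) is sharp: for each $p\in[1,2]$ and each bounded interval $Q$ there is $\varphi\in{\rm BMO}(Q)$ with $0<\min\{\varepsilon_\varphi,\varepsilon_{-\varphi}\}<\infty$ for which (1) holds with equality. -/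

import Mathlib

open MeasureTheory Set
open scoped ENNReal NNReal

/-- The pairs of endpoints of the subintervals of `Q`: `IsSubinterval Q a b` says that `(a, b)` is a
bounded nondegenerate interval contained in `Q`. Endpoints form a null set, so only open intervals
are used. -/
def IsSubinterval (Q : Set ℝ) (a b : ℝ) : Prop :=
  a < b ∧ Ioo a b ⊆ Q

/-- `g` is locally integrable: integrable on each bounded interval contained in `Q`
(for a bounded interval `Q` this is `L¹(Q)`, for `Q = ℝ` it is `L¹_loc(ℝ)`). -/
def LocIntegrable (Q : Set ℝ) (g : ℝ → ℝ) : Prop :=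
  ∀ a b : ℝ, IsSubinterval Q a b → IntegrableOn g (Ioo a b) volume

/-- The `BMO^p` norm on `Q`: the supremum over all subintervals `J = (a, b)` of `Q` of
`⟨|φ - ⟨φ⟩_J|^p⟩_J ^ (1/p)`, with values in `[0, ∞]`. -/
noncomputable def bmoNorm (p : ℝ) (Q : Set ℝ) (φ : ℝ → ℝ) : ℝ≥0∞ :=
  ⨆ (a : ℝ) (b : ℝ) (_ : IsSubinterval Q a b),
    (⨍⁻ t in Ioo a b, ENNReal.ofReal (|φ t - ⨍ s in Ioo a b, φ s| ^ p) ∂volume) ^ (1 / p)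

/-- `φ ∈ BMO^p(Q)`. -/
def MemBMO (p : ℝ) (Q : Set ℝ) (φ : ℝ → ℝ) : Prop :=
  LocIntegrable Q φ ∧ bmoNorm p Q φ < ∞

/-- The `A_∞` characteristic `sup_J ⟨w⟩_J exp(-⟨log w⟩_J)` of a weight `w` on `Q`. -/
noncomputable def aInftyChar (Q : Set ℝ) (w : ℝ → ℝ) : ℝ≥0∞ :=
  ⨆ (a : ℝ) (b : ℝ) (_ : IsSubinterval Q a b),
    (⨍⁻ t in Ioo a b, ENNReal.ofReal (w t) ∂volume) *
      ENNReal.ofReal (Real.exp (-(⨍ t in Ioo a b, Real.log (w t))))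

/-- `w ∈ A_∞(Q)`: `w` is almost everywhere positive on `Q`, both `w` and `log w` are locally
integrable, and the `A_∞` characteristic is finite. -/
def MemAInfty (Q : Set ℝ) (w : ℝ → ℝ) : Prop :=
  (∀ᵐ t ∂(volume.restrict Q), 0 < w t) ∧
    LocIntegrable Q w ∧ LocIntegrable Q (fun t => Real.log (w t)) ∧ aInftyChar Q w < ∞

/-- `ε_φ = sup {ε > 0 : e^{ε φ} ∈ A_∞(Q)}`, with values in `[0, ∞]`. -/
noncomputable def epsSup (Q : Set ℝ) (φ : ℝ → ℝ) : ℝ≥0∞ :=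
  ⨆ (ε : ℝ) (_ : 0 < ε) (_ : MemAInfty Q (fun t => Real.exp (ε * φ t))), ENNReal.ofReal ε

/-- The integral John--Nirenberg inequality on `(0, 1)` holds below the threshold `ε₀`: for each
`ε < ε₀` there is a finite constant `C` such that `⟨e^φ⟩_J ≤ C e^{⟨φ⟩_J}` for all
`φ ∈ BMO((0, 1))` with `‖φ‖_{BMO^p} ≤ ε` and all subintervals `J` of `(0, 1)`. -/
def JohnNirenbergBelow (p : ℝ) (ε₀ : ℝ≥0∞) : Prop :=
  ∀ ε : ℝ≥0∞, ε < ε₀ → ∃ C : ℝ≥0, ∀ φ : ℝ → ℝ,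
    MemBMO p (Ioo 0 1) φ → bmoNorm p (Ioo 0 1) φ ≤ ε →
      ∀ a b : ℝ, IsSubinterval (Ioo 0 1) a b →
        (⨍⁻ t in Ioo a b, ENNReal.ofReal (Real.exp (φ t)) ∂volume) ≤
          (C : ℝ≥0∞) * ENNReal.ofReal (Real.exp (⨍ t in Ioo a b, φ t))

/-- The John--Nirenberg constant `ε₀(p)` of `BMO^p((0, 1))`: the largest threshold in the integral
John--Nirenberg inequality. -/
noncomputable def johnNirenbergConst (p : ℝ) : ℝ≥0∞ :=
  sSup {ε₀ : ℝ≥0∞ | JohnNirenbergBelow p ε₀}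

/-- The distance `inf_{f ∈ L^∞(Q)} ‖φ - f‖_{BMO^p(Q)}`. -/
noncomputable def bmoDistLInfty (p : ℝ) (Q : Set ℝ) (φ : ℝ → ℝ) : ℝ≥0∞ :=
  ⨅ (f : ℝ → ℝ) (_ : MemLp f ∞ (volume.restrict Q)), bmoNorm p Q (fun t => φ t - f t)

/-! The lower bound is soft. If `f` is bounded and `ε * ‖φ - f‖` is below the John–Nirenberg
constant, scale invariance gives `⟨e^{±ε(φ-f)}⟩_J ≤ C e^{±ε⟨φ-f⟩_J}` on all `J`; the bounded factor
`e^{±εf}` only changes `C`, so `e^{±εφ}` are `A_∞` weights (`memAInfty_exp_of_lt`) and both critical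
exponents are at least `ε`.

For sharpness take `φ = -log (t - inf Q)`. Non-integrability of `1/s` at 0 gives `ε_φ ≤ 1`, and the
norm of `φ` is at most `L^{1/p}`, where `L = ∫₀¹ |log t + 1|^p` (`bmoNorm_neg_log_le`). With
`L^{1/p} ≤ ε₀(p)`, the distance of `φ` to `L^∞` is at most `ε₀(p)`, hence at most `ε₀(p) / min`, and
the lower bound closes the circle.

The hard part is `L^{1/p} ≤ ε₀(p)` (`johnNirenbergBelow_logMoment`). Let `g` have mean zero on `(a,
b)` and `p`-th power oscillation at most `ε < L`. For each level `A = log τ ≥ 0` the rising sun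
lemma produces disjoint intervals on which `g` has mean exactly `A`, so `|g - A|^p - ε + κ(g - A)`
has nonpositive integral over their union. Integrate over `τ` and exchange the order. For almost
every `x` the levels whose union contains `x` fill `1 < τ < θ` with `θ ≥ min (e^{g x}) T`, and for a
suitable `κ` the integral over them is at least `(L - ε)θ` minus a multiple of `1 + |g x|^p`. This
bounds the mean of `min (e^g) T` uniformly in `T`. -/

/-! ### Rising sun lemma and components of open sets -/

/-- The region below the graph of `F` lit by a horizontal ray from the right end, with the values
of `F` cut off at `0`. -/
def risingSet (F : ℝ → ℝ) (a b : ℝ) : Set ℝ :=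
  {x | x ∈ Ioo a b ∧ ∃ y ∈ Ioo x b, min (F x) 0 < F y}

/-- A rising sun lemma: `F` takes equal values at the ends of each component of `risingSet F a b`,
including components that touch the ends of `(a, b)`. -/
theorem rising_sun {F : ℝ → ℝ} (hF : Continuous F) {a b c d : ℝ} (ha : F a = 0) (hb : F b ≤ 0)
    (hac : a ≤ c) (hcd : c < d) (hdb : d ≤ b) (hsub : Ioo c d ⊆ risingSet F a b)
    (hc : c ∉ risingSet F a b) (hd : d ∉ risingSet F a b) : F c = F d := by
  have lim_right : ∀ x M : ℝ, x < b → (∀ y ∈ Ioo x b, F y ≤ M) → F x ≤ M ∧ ∀ y ∈ Icc x b, F y ≤ M := by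
    intro x M hx h
    have hcl : Icc x b ⊆ {y | F y ≤ M} := by
      rw [← closure_Ioo hx.ne]
      exact closure_minimal h (isClosed_le hF continuous_const)
    exact ⟨hcl ⟨le_rfl, hx.le⟩, fun y hy => hcl hy⟩
  have hcb : c < b := hcd.trans_le hdb
  have out : ∀ x, x ∈ Ioo a b → x ∉ risingSet F a b → ∀ y ∈ Ioo x b, F y ≤ min (F x) 0 := by
    intro x hx hn y hy
    by_contra! hlt
    exact hn ⟨hx, y, hy, hlt⟩
  have hd0 : F d ≤ 0 := by
    rcases hdb.eq_or_lt with rfl | hdb'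
    · exact hb
    · exact (lim_right d 0 hdb' fun y hy =>
        (out d ⟨hac.trans_lt hcd, hdb'⟩ hd y hy).trans (min_le_right _ _)).1
  have hdc : F d ≤ F c := by
    rcases hac.eq_or_lt with rfl | hac'
    · rw [ha]; exact hd0
    · exact (lim_right c (F c) hcb fun y hy =>
        (out c ⟨hac', hcb⟩ hc y hy).trans (min_le_left _ _)).2 d ⟨hcd.le, hdb⟩
  have hc0 : F c ≤ 0 := by
    rcases hac.eq_or_lt with rfl | hac'
    · rw [ha]
    · exact (lim_right c 0 hcb fun y hy =>
        (out c ⟨hac', hcb⟩ hc y hy).trans (min_le_right _ _)).1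
  -- If this failed, the last point of `[x, d]` where `F` is at least `min (F x) 0` would lie before
  -- `d`, and a higher point to its right could lie neither in `[x, d]` nor beyond `d`.
  have key : ∀ x ∈ Ioo c d, min (F x) 0 ≤ F d := by
    intro x hx
    by_contra! hlt
    have hK : IsCompact (Icc x d ∩ {z | min (F x) 0 ≤ F z}) :=
      isCompact_Icc.inter_right (isClosed_le continuous_const hF)
    obtain ⟨z, ⟨hz1, hz2⟩, hzmax⟩ := hK.exists_isGreatest
        ⟨x, ⟨le_rfl, hx.2.le⟩, show min (F x) 0 ≤ F x from min_le_left _ _⟩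
    have hz2' : min (F x) 0 ≤ F z := hz2
    have hzd : z < d := hz1.2.lt_of_ne (by rintro rfl; exact absurd hz2' (not_le.2 hlt))
    obtain ⟨-, y, hy, hFy⟩ := hsub ⟨hx.1.trans_le hz1.1, hzd⟩
    have hFy' : min (F x) 0 < F y := (le_min hz2' (min_le_right _ _)).trans_lt hFy
    rcases le_or_gt y d with hyd | hyd
    · exact absurd (hzmax ⟨⟨hz1.1.trans hy.1.le, hyd⟩, hFy'.le⟩) (not_le.2 hy.1)
    · have hdb' : d < b := hyd.trans hy.2
      have := out d ⟨hac.trans_lt hcd, hdb'⟩ hd y ⟨hyd, hy.2⟩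
      have := this.trans (min_le_left _ _)
      linarith
  have hcl : Icc c d ⊆ {x | min (F x) 0 ≤ F d} := by
    rw [← closure_Ioo hcd.ne]
    exact closure_minimal key (isClosed_le (hF.min continuous_const) continuous_const)
  have := hcl ⟨le_rfl, hcd.le⟩
  simp only [mem_ofPred_eq, min_eq_left hc0] at this
  linarith

theorem isOpen_risingSet {F : ℝ → ℝ} (hF : Continuous F) (a b : ℝ) :
    IsOpen (risingSet F a b) := by
  have : risingSet F a b = Ioo a b ∩ ⋃ y ∈ Iio b, {x | x < y ∧ min (F x) 0 < F y} := by
    ext x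
    simp only [risingSet, mem_ofPred_eq, mem_inter_iff, mem_iUnion, mem_Iio, mem_Ioo]
    constructor
    · rintro ⟨h, y, hy, h'⟩; exact ⟨h, y, hy.2, hy.1, h'⟩
    · rintro ⟨h, y, hy, hy', h'⟩; exact ⟨h, y, ⟨hy', hy⟩, h'⟩
  rw [this]
  refine isOpen_Ioo.inter (isOpen_biUnion fun y _ => ?_)
  exact (isOpen_lt continuous_id continuous_const).inter
    (isOpen_lt (hF.min continuous_const) continuous_const)

/-- A bounded open set of reals is a countable disjoint union of open intervals whose ends are
outside the set. -/
theorem exists_countable_components {U : Set ℝ} (hU : IsOpen U) {a b : ℝ} (hab : U ⊆ Ioo a b) :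
    ∃ S : Set (ℝ × ℝ), S.Countable ∧ U = ⋃ q ∈ S, Ioo q.1 q.2 ∧
      S.PairwiseDisjoint (fun q => Ioo q.1 q.2) ∧
      ∀ q ∈ S, a ≤ q.1 ∧ q.1 < q.2 ∧ q.2 ≤ b ∧ Ioo q.1 q.2 ⊆ U ∧ q.1 ∉ U ∧ q.2 ∉ U := by
  -- Excluding the endpoints from `U` makes each such interval maximal, so two of them that meet
  -- coincide.
  set S : Set (ℝ × ℝ) := {q | q.1 < q.2 ∧ Ioo q.1 q.2 ⊆ U ∧ q.1 ∉ U ∧ q.2 ∉ U} with hS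
  have hdis : S.PairwiseDisjoint (fun q => Ioo q.1 q.2) := by
    rintro ⟨c, d⟩ ⟨hcd, hs, hc, hd⟩ ⟨c', d'⟩ ⟨hcd', hs', hc', hd'⟩ hne
    simp only at hcd hs hc hd hcd' hs' hc' hd'
    rw [Function.onFun, Set.disjoint_left]
    rintro x ⟨h1, h2⟩ ⟨h3, h4⟩
    apply hne
    simp only at h1 h2 h3 h4
    have e1 : c = c' := by
      rcases lt_trichotomy c c' with h | h | h
      · exact absurd (hs ⟨h, h3.trans h2⟩) hc'
      · exact h
      · exact absurd (hs' ⟨h, h1.trans h4⟩) hc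
    have e2 : d = d' := by
      rcases lt_trichotomy d d' with h | h | h
      · exact absurd (hs' ⟨h3.trans h2, h⟩) hd
      · exact h
      · exact absurd (hs ⟨h1.trans h4, h⟩) hd'
    rw [e1, e2]
  refine ⟨S, hdis.countable_of_isOpen (fun _ _ => isOpen_Ioo) (fun q hq => nonempty_Ioo.2 hq.1),
    ?_, hdis, ?_⟩
  · apply Subset.antisymm
    · intro x hx
      have hxab := hab hx
      obtain ⟨c, ⟨hc1, hc2⟩, hcm⟩ := (isCompact_Icc.inter_right hU.isClosed_compl :
        IsCompact (Icc a x ∩ Uᶜ)).exists_isGreatest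
          ⟨a, ⟨le_rfl, hxab.1.le⟩, fun h => lt_irrefl _ (hab h).1⟩
      obtain ⟨d, ⟨hd1, hd2⟩, hdm⟩ := (isCompact_Icc.inter_right hU.isClosed_compl :
        IsCompact (Icc x b ∩ Uᶜ)).exists_isLeast
          ⟨b, ⟨hxab.2.le, le_rfl⟩, fun h => lt_irrefl _ (hab h).2⟩
      have hcx : c < x := hc1.2.lt_of_ne (by rintro rfl; exact hc2 hx)
      have hxd : x < d := hd1.1.lt_of_ne (by rintro rfl; exact hd2 hx)
      refine mem_biUnion (x := (c, d)) ⟨hcx.trans hxd, ?_, hc2, hd2⟩ ⟨hcx, hxd⟩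
      intro y hy
      by_contra hyU
      rcases le_total y x with h | h
      · exact absurd (hcm ⟨⟨hc1.1.trans hy.1.le, h⟩, hyU⟩) (not_le.2 hy.1)
      · exact absurd (hdm ⟨⟨h, hy.2.le.trans hd1.2⟩, hyU⟩) (not_le.2 hy.2)
    · exact iUnion₂_subset fun q hq => hq.2.1
  · rintro ⟨c, d⟩ ⟨hcd, hs, hc, hd⟩
    have h := closure_mono (hs.trans hab)
    rw [closure_Ioo (ne_of_lt hcd)] at h
    have hab' : a < b := by
      have := (hs.trans hab) (show (c + d) / 2 ∈ Ioo c d from ⟨by simp only at hcd; linarith, by simp only at hcd; linarith⟩)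
      exact this.1.trans this.2
    rw [closure_Ioo hab'.ne] at h
    exact ⟨(h ⟨le_rfl, le_of_lt hcd⟩).1, hcd, (h ⟨le_of_lt hcd, le_rfl⟩).2, hs, hc, hd⟩

/-! ### Convexity of powers and moments of the logarithm -/

theorem abs_add_rpow_le {p : ℝ} (hp : 1 ≤ p) (u v : ℝ) :
    |u + v| ^ p ≤ 2 ^ p * (|u| ^ p + |v| ^ p) := by
  have hp0 : 0 ≤ p := by linarith
  have h1 : |u + v| ≤ 2 * max |u| |v| := by
    have := abs_add_le u v
    have := le_max_left |u| |v|
    have := le_max_right |u| |v|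
    linarith
  calc |u + v| ^ p ≤ (2 * max |u| |v|) ^ p := Real.rpow_le_rpow (abs_nonneg _) h1 hp0
    _ = 2 ^ p * (max |u| |v|) ^ p := Real.mul_rpow (by norm_num) (by positivity)
    _ ≤ _ := by
      gcongr
      rcases max_choice |u| |v| with h | h <;> rw [h]
      · linarith [Real.rpow_nonneg (abs_nonneg v) p]
      · linarith [Real.rpow_nonneg (abs_nonneg u) p]

theorem abs_le_one_add_rpow {p : ℝ} (hp : 1 ≤ p) (u : ℝ) : |u| ≤ 1 + |u| ^ p := by
  rcases le_total |u| 1 with h | h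
  · linarith [Real.rpow_nonneg (abs_nonneg u) p]
  · linarith [Real.self_le_rpow_of_one_le h hp]

theorem convexOn_abs_rpow {p : ℝ} (hp : 1 ≤ p) : ConvexOn ℝ univ (fun x : ℝ => |x| ^ p) := by
  refine ⟨convex_univ, fun x _ y _ a b ha hb hab => ?_⟩
  calc |a • x + b • y| ^ p ≤ (a • |x| + b • |y|) ^ p := by
        refine Real.rpow_le_rpow (abs_nonneg _) ?_ (by linarith)
        refine (abs_add_le _ _).trans (le_of_eq ?_)
        simp [abs_mul, abs_of_nonneg ha, abs_of_nonneg hb]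
    _ ≤ _ := (convexOn_rpow hp).2 (abs_nonneg x) (abs_nonneg y) ha hb hab

theorem ConvexOn.exists_support_slope {f : ℝ → ℝ} (hf : ConvexOn ℝ univ f) (x : ℝ) :
    ∃ k, ∀ y, f x + k * (y - x) ≤ f y := by
  refine ⟨derivWithin f (Ioi x) x, fun y => ?_⟩
  rcases lt_trichotomy y x with h | rfl | h
  · have h1 := hf.slope_le_leftDeriv_of_mem_interior (mem_univ y) (by simp : x ∈ interior univ) h
    have h2 := hf.leftDeriv_le_rightDeriv_of_mem_interior (by simp : x ∈ interior univ)
    have h3 := h1.trans h2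
    rw [slope_def_field, div_le_iff₀ (by linarith)] at h3
    linarith
  · simp
  · have h3 := hf.rightDeriv_le_slope_of_mem_interior (by simp : x ∈ interior univ) (mem_univ y) h
    rw [slope_def_field, le_div_iff₀ (by linarith)] at h3
    linarith

theorem intervalIntegrable_abs_log_rpow {p : ℝ} (hp : 1 ≤ p) :
    IntervalIntegrable (fun t => |Real.log t| ^ p) volume 0 1 := by
  have hp0 : 0 < p := by linarith
  have h := (intervalIntegral.intervalIntegrable_rpow' (a := 0) (b := 1) (r := -(1 / 2))
    (by norm_num)).const_mul ((2 * p) ^ p)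
  rw [intervalIntegrable_iff_integrableOn_Ioo_of_le zero_le_one] at h ⊢
  refine h.mono' (Measurable.aestronglyMeasurable (by fun_prop)) ?_
  refine (ae_restrict_iff' measurableSet_Ioo).2 (.of_forall fun t ht => ?_)
  have ht0 : 0 < t := ht.1
  -- The exponent `1 / (2 * p)` turns into the integrable singularity `t ^ (-1/2)` after raising to
  -- the power `p`.
  have hs : 0 < 1 / (2 * p) := by positivity
  have h1 := Real.abs_log_mul_self_rpow_lt t (1 / (2 * p)) ht0 ht.2.le hs
  rw [abs_mul, abs_of_pos (Real.rpow_pos_of_pos ht0 _), one_div_one_div,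
    ← lt_div_iff₀ (Real.rpow_pos_of_pos ht0 _)] at h1
  rw [Real.norm_of_nonneg (by positivity)]
  calc |Real.log t| ^ p ≤ (2 * p / t ^ (1 / (2 * p))) ^ p :=
        Real.rpow_le_rpow (abs_nonneg _) h1.le hp0.le
    _ = (2 * p) ^ p * t ^ (-(1 / 2) : ℝ) := by
        rw [Real.div_rpow (by positivity) (by positivity), ← Real.rpow_mul ht0.le,
          Real.rpow_neg ht0.le, div_eq_mul_inv]
        congr 3
        field_simp

/-- The moment `∫₀¹ |log t + d|^p dt`. -/
noncomputable def logMoment (p d : ℝ) : ℝ := ∫ t in (0 : ℝ)..1, |Real.log t + d| ^ p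

theorem intervalIntegrable_logMoment {p : ℝ} (hp : 1 ≤ p) (d : ℝ) :
    IntervalIntegrable (fun t => |Real.log t + d| ^ p) volume 0 1 := by
  refine (((intervalIntegrable_abs_log_rpow hp).add
    (intervalIntegrable_const (c := |d| ^ p))).const_mul (2 ^ p)).mono_fun' ?_ ?_
  · exact Measurable.aestronglyMeasurable (by fun_prop)
  · refine .of_forall fun t => ?_
    simp only
    rw [Real.norm_of_nonneg (by positivity)]
    exact abs_add_rpow_le hp _ _

theorem logMoment_le {p : ℝ} (hp : 1 ≤ p) : ∃ C, 0 ≤ C ∧ ∀ d, logMoment p d ≤ C * (1 + |d| ^ p) := by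
  set M := ∫ t in (0 : ℝ)..1, |Real.log t| ^ p with hM
  have hM0 : 0 ≤ M := intervalIntegral.integral_nonneg zero_le_one fun t _ => by positivity
  refine ⟨2 ^ p * (M + 1), by positivity, fun d => ?_⟩
  have h : logMoment p d ≤ 2 ^ p * (M + |d| ^ p) := by
    calc logMoment p d ≤ ∫ t in (0 : ℝ)..1, 2 ^ p * (|Real.log t| ^ p + |d| ^ p) := by
          refine intervalIntegral.integral_mono_on zero_le_one (intervalIntegrable_logMoment hp d)
            (((intervalIntegrable_abs_log_rpow hp).add intervalIntegrable_const).const_mul _)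
            fun t _ => abs_add_rpow_le hp _ _
      _ = _ := by
          rw [intervalIntegral.integral_const_mul, intervalIntegral.integral_add
            (intervalIntegrable_abs_log_rpow hp) intervalIntegrable_const]
          simp [hM]
  refine h.trans ?_
  rw [mul_assoc]
  gcongr
  have := Real.rpow_nonneg (abs_nonneg d) p
  nlinarith

theorem convexOn_logMoment {p : ℝ} (hp : 1 ≤ p) : ConvexOn ℝ univ (logMoment p) := by
  refine ⟨convex_univ, fun x _ y _ a b ha hb hab => ?_⟩
  have hx := intervalIntegrable_logMoment hp x
  have hy := intervalIntegrable_logMoment hp y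
  simp only [logMoment, smul_eq_mul]
  rw [← intervalIntegral.integral_const_mul, ← intervalIntegral.integral_const_mul,
    ← intervalIntegral.integral_add (hx.const_mul a) (hy.const_mul b)]
  refine intervalIntegral.integral_mono_on zero_le_one (intervalIntegrable_logMoment hp _)
    ((hx.const_mul a).add (hy.const_mul b)) fun t _ => ?_
  have := (convexOn_abs_rpow hp).2 (mem_univ (Real.log t + x)) (mem_univ (Real.log t + y)) ha hb hab
  simp only [smul_eq_mul] at this
  refine le_trans (le_of_eq ?_) this
  congr 2
  linear_combination (-Real.log t) * hab

theorem logMoment_one_pos {p : ℝ} (hp : 1 ≤ p) : 0 < logMoment p 1 := by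
  have h1 : Real.exp (-2) ≤ 1 := Real.exp_le_one_iff.2 (by norm_num)
  have h0 := Real.exp_pos (-2)
  have hi := intervalIntegrable_logMoment hp 1
  have hia : IntervalIntegrable (fun t => |Real.log t + 1| ^ p) volume 0 (Real.exp (-2)) :=
    hi.mono_set (by rw [uIcc_of_le h0.le, uIcc_of_le zero_le_one]; exact Icc_subset_Icc_right h1)
  calc 0 < ∫ _t in (0 : ℝ)..Real.exp (-2), (1 : ℝ) := by simpa using h0
    _ ≤ ∫ t in (0 : ℝ)..Real.exp (-2), |Real.log t + 1| ^ p := by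
      refine intervalIntegral.integral_mono_on_of_le_Ioo h0.le intervalIntegrable_const hia fun t ht => ?_
      have : Real.log t < -2 := (Real.log_lt_iff_lt_exp ht.1).2 ht.2
      refine Real.one_le_rpow ?_ (by linarith)
      rw [abs_of_neg (by linarith)]; linarith
    _ ≤ _ := by
      refine intervalIntegral.integral_mono_interval le_rfl h0.le h1 (.of_forall fun t => ?_) hi
      positivity

theorem integral_log_zero_one : ∫ t in (0 : ℝ)..1, Real.log t = -1 := by
  rw [integral_log]; simp

/-- Integration over the levels `log τ`, `1 ≤ τ ≤ θ`. -/
theorem exists_level_integral_lower_bound {p : ℝ} (hp : 1 ≤ p) {ε : ℝ} (hε : 0 ≤ ε) :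
    ∃ κ C : ℝ, 0 ≤ C ∧ ∀ u θ : ℝ, 1 ≤ θ →
      (logMoment p 1 - ε) * θ - C * (1 + |u| ^ p) ≤
        ∫ τ in (1 : ℝ)..θ, (|u - Real.log τ| ^ p - ε + κ * (u - Real.log τ)) := by
  -- The point 1 is where `log t + d` has mean zero on `(0, 1)`. Subtracting this supporting line
  -- makes the moment at least `logMoment p 1` for every shift `d`.
  obtain ⟨κ, hκ⟩ := (convexOn_logMoment hp).exists_support_slope 1
  obtain ⟨C, hC, hCb⟩ := logMoment_le hp
  refine ⟨κ, C + 2 * |κ|, by positivity, fun u θ hθ => ?_⟩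
  set f : ℝ → ℝ := fun τ => |u - Real.log τ| ^ p - ε + κ * (u - Real.log τ) with hf
  have hθ0 : 0 < θ := by linarith
  have hlog : IntervalIntegrable Real.log volume 0 1 := intervalIntegral.intervalIntegrable_log'
  -- Substituting `τ = θ t` turns the integral over `(0, θ)` into `θ` times a moment with shift `log
  -- θ - u`.
  have hscale : ∀ θ : ℝ, 0 < θ → ∀ t ∈ Ioc (0 : ℝ) 1, f (θ * t) =
      |Real.log t + (Real.log θ - u)| ^ p - ε - κ * (Real.log t + (Real.log θ - u)) := by
    intro θ hθ t ht
    simp only [hf]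
    rw [Real.log_mul hθ.ne' ht.1.ne', ← abs_neg]
    ring_nf
  have hint : ∀ d, IntervalIntegrable (fun t => |Real.log t + d| ^ p - ε - κ * (Real.log t + d))
      volume 0 1 := fun d =>
    ((intervalIntegrable_logMoment hp d).sub intervalIntegrable_const).sub
      ((hlog.add intervalIntegrable_const).const_mul κ)
  have hval : ∀ d, ∫ t in (0 : ℝ)..1, (|Real.log t + d| ^ p - ε - κ * (Real.log t + d)) =
      logMoment p d - ε - κ * (d - 1) := by
    intro d
    rw [intervalIntegral.integral_sub
      ((intervalIntegrable_logMoment hp d).sub intervalIntegrable_const)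
      ((hlog.add intervalIntegrable_const).const_mul κ),
      intervalIntegral.integral_sub (intervalIntegrable_logMoment hp d) intervalIntegrable_const,
      intervalIntegral.integral_const_mul, intervalIntegral.integral_add hlog
      intervalIntegrable_const, integral_log_zero_one, logMoment]
    simp only [intervalIntegral.integral_const, sub_zero, one_smul]
    ring
  have hfi : ∀ θ : ℝ, 0 < θ → IntervalIntegrable f volume 0 θ ∧
      ∫ τ in (0 : ℝ)..θ, f τ =
        θ * (logMoment p (Real.log θ - u) - ε - κ * (Real.log θ - u - 1)) := by
    intro θ hθ
    have h1 : IntervalIntegrable (fun t => f (θ * t)) volume 0 1 := by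
      refine (hint (Real.log θ - u)).congr ?_
      rw [uIoc_of_le zero_le_one]
      intro t ht
      exact (hscale θ hθ t ht).symm
    refine ⟨?_, ?_⟩
    · have := h1.comp_mul_left (c := θ⁻¹)
      simp only [mul_inv_cancel_left₀ hθ.ne', zero_mul, div_inv_eq_mul, one_mul] at this
      exact this
    · have h2 := intervalIntegral.mul_integral_comp_mul_left (f := f) (a := 0) (b := 1) θ
      rw [mul_zero, mul_one] at h2
      rw [← h2, ← hval]
      congr 1
      refine intervalIntegral.integral_congr_ae (.of_forall fun t ht => ?_)
      rw [uIoc_of_le zero_le_one] at ht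
      exact hscale θ hθ t ht
  obtain ⟨i1, v1⟩ := hfi 1 one_pos
  obtain ⟨i2, v2⟩ := hfi θ hθ0
  rw [← intervalIntegral.integral_interval_sub_left i2 i1, v1, v2]
  have h1 := hκ (Real.log θ - u)
  have h2 := hCb (-u)
  have h3 : θ * (logMoment p 1 - ε) ≤
      θ * (logMoment p (Real.log θ - u) - ε - κ * (Real.log θ - u - 1)) :=
    mul_le_mul_of_nonneg_left (by linarith) hθ0.le
  have h4 : κ * (u + 1) ≤ 2 * |κ| * (1 + |u| ^ p) := by
    calc κ * (u + 1) ≤ |κ| * (|u| + 1) := by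
          refine (le_abs_self _).trans ?_
          rw [abs_mul]
          gcongr
          exact (abs_add_le _ _).trans (by simp)
      _ ≤ |κ| * (2 * (1 + |u| ^ p)) := by
          gcongr
          have := abs_le_one_add_rpow hp u
          have := Real.rpow_nonneg (abs_nonneg u) p
          linarith
      _ = _ := by ring
  simp only [Real.log_one, zero_sub, abs_neg] at h2 ⊢
  linarith

/-! ### Exponential integrability from the level sets -/

theorem setIntegral_risingSet_nonpos {F : ℝ → ℝ} (hF : Continuous F) {a b : ℝ} (ha : F a = 0)
    (hb : F b ≤ 0) {h : ℝ → ℝ} (hi : IntegrableOn h (Ioo a b))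
    (hc : ∀ c d, a ≤ c → c < d → d ≤ b → F c = F d → ∫ x in Ioo c d, h x ≤ 0) :
    ∫ x in risingSet F a b, h x ≤ 0 := by
  have hsub : risingSet F a b ⊆ Ioo a b := fun x hx => hx.1
  obtain ⟨S, hS, hU, hdis, hq⟩ := exists_countable_components (isOpen_risingSet hF a b) hsub
  have := hS.to_subtype
  have hi' := hi.mono_set hsub
  rw [hU, biUnion_eq_iUnion] at hi' ⊢
  rw [integral_iUnion (s := fun q : S => Ioo q.1.1 q.1.2) (fun _ => measurableSet_Ioo)
    (fun i j hij => hdis i.2 j.2 (fun h => hij (Subtype.ext h))) hi']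
  refine tsum_nonpos fun q => ?_
  obtain ⟨h1, h2, h3, h4, h5, h6⟩ := hq q q.2
  exact hc _ _ h1 h2 h3 (rising_sun hF ha hb h1 h2 h3 h4 h5 h6)

/-- The primitive of `g - A` that vanishes at `a`. -/
noncomputable def levelPrim (g : ℝ → ℝ) (a A x : ℝ) : ℝ := (∫ t in a..x, g t) - A * (x - a)

theorem continuous_levelPrim {g : ℝ → ℝ} (hg : Integrable g) (a : ℝ) :
    Continuous fun q : ℝ × ℝ => levelPrim g a q.1 q.2 := by
  have h := intervalIntegral.continuous_primitive (fun c d => hg.intervalIntegrable (a := c) (b := d)) a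
  unfold levelPrim
  exact (h.comp continuous_snd).sub (by fun_prop)

/-- Equal values of the primitive at the ends of a component mean that `g` has average `A` there.
The oscillation bound then applies with `A` as centre, and the `κ` term integrates to zero, which
leaves `κ` free. -/
theorem setIntegral_level_nonpos {g : ℝ → ℝ} (hg : Integrable g) {p ε κ A a b : ℝ} (hp : 1 ≤ p)
    (hab : a < b) (hA : 0 ≤ A) (h0 : ∫ x in Ioo a b, g x = 0)
    (hgp : IntegrableOn (fun x => |g x| ^ p) (Ioo a b))
    (hosc : ∀ c d, a ≤ c → c < d → d ≤ b →
      ∫ x in Ioo c d, |g x - ⨍ y in Ioo c d, g y| ^ p ≤ ε * (d - c)) :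
    ∫ x in risingSet (levelPrim g a A) a b, (|g x - A| ^ p - ε + κ * (g x - A)) ≤ 0 := by
  have hF : Continuous (levelPrim g a A) :=
    (continuous_levelPrim hg a).comp (continuous_const.prodMk continuous_id)
  have hint : IntegrableOn (fun x => |g x - A| ^ p) (Ioo a b) := by
    refine Integrable.mono' ((hgp.add (integrable_const (|A| ^ p))).const_mul (2 ^ p)) ?_ ?_
    · exact (Measurable.comp_aemeasurable (g := fun u : ℝ => |u - A| ^ p) (by fun_prop)
        hg.aestronglyMeasurable.aemeasurable.restrict).aestronglyMeasurable
    · refine .of_forall fun x => ?_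
      rw [Real.norm_of_nonneg (by positivity)]
      simpa [sub_eq_add_neg] using abs_add_rpow_le hp (g x) (-A)
  have hc : ∀ c d, IntegrableOn (fun _ : ℝ => ε) (Ioo c d) := fun c d => integrable_const ε
  have hgA : ∀ c d, IntegrableOn (fun x => κ * (g x - A)) (Ioo c d) := fun c d =>
    (hg.integrableOn.sub (integrable_const A)).const_mul κ
  refine setIntegral_risingSet_nonpos hF (by simp [levelPrim]) ?_ ((hint.sub (hc a b)).add (hgA a b)) ?_
  -- The mean of `g` is zero and `A` is nonnegative, so the primitive ends at or below 0, as the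
  -- rising sun lemma requires.
  · rw [levelPrim, intervalIntegral.integral_of_le hab.le, integral_Ioc_eq_integral_Ioo, h0]
    have := mul_nonneg hA (sub_nonneg.2 hab.le)
    linarith
  · intro c d hac hcd hdb hFcd
    have hi := hint.mono_set (Ioo_subset_Ioo hac hdb)
    have hgint : ∫ x in Ioo c d, g x = A * (d - c) := by
      rw [← integral_Ioc_eq_integral_Ioo, ← intervalIntegral.integral_of_le hcd.le,
        ← intervalIntegral.integral_interval_sub_left hg.intervalIntegrable hg.intervalIntegrable
          (a := a)]
      simp only [levelPrim] at hFcd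
      linarith
    have hvol : volume.real (Ioo c d) = d - c := by
      simp [Measure.real, Real.volume_Ioo, ENNReal.toReal_ofReal, hcd.le]
    have hdc : d - c ≠ 0 := by linarith
    have hav : ⨍ y in Ioo c d, g y = A := by
      rw [setAverage_eq, hgint, hvol, smul_eq_mul]
      field_simp
    have := hosc c d hac hcd hdb
    rw [hav] at this
    have hiε : IntegrableOn (fun x => |g x - A| ^ p - ε) (Ioo c d) := hi.sub (hc c d)
    rw [integral_add hiε (hgA c d), integral_sub hi (hc c d),
      integral_const_mul, integral_sub hg.integrableOn (integrable_const A), hgint]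
    simp only [integral_const, smul_eq_mul, measureReal_restrict_apply_univ, hvol]
    nlinarith

/-- The primitive of `g - A` has positive derivative at `x`, so it exceeds its value at `x`
somewhere just to the right. -/
theorem mem_risingSet_of_lt {g : ℝ → ℝ} {a b x A : ℝ} (hx : x ∈ Ioo a b) (hA : A < g x)
    (hd : HasDerivAt (fun y => ∫ t in a..y, g t) (g x) x) :
    x ∈ risingSet (levelPrim g a A) a b := by
  have hd' : HasDerivAt (levelPrim g a A) (g x - A) x := by
    have : HasDerivAt (fun y => (∫ t in a..y, g t) - A * (y - a)) (g x - A * 1) x :=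
      hd.sub (((hasDerivAt_id x).sub_const a).const_mul A)
    rwa [mul_one] at this
  have h1 := hd'.hasDerivWithinAt (s := Ioi x)
  rw [hasDerivWithinAt_iff_tendsto_slope' self_notMem_Ioi] at h1
  have h2 := (h1.eventually (lt_mem_nhds (sub_pos.2 hA))).and (Ioo_mem_nhdsGT hx.2)
  obtain ⟨y, hy, hyb⟩ := h2.exists
  refine ⟨hx, y, hyb, ?_⟩
  rw [slope_def_field] at hy
  have := (div_pos_iff_of_pos_right (sub_pos.2 hyb.1)).1 hy
  exact (min_le_left _ _).trans_lt (by linarith)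

theorem risingSet_levelPrim_anti {g : ℝ → ℝ} {a b A B : ℝ} (h : A ≤ B) :
    risingSet (levelPrim g a B) a b ⊆ risingSet (levelPrim g a A) a b := by
  rintro x ⟨hx, y, hy, hlt⟩
  refine ⟨hx, y, hy, ?_⟩
  simp only [levelPrim] at hlt ⊢
  have h1 := mul_le_mul_of_nonneg_right h (sub_nonneg.2 hy.1.le)
  have h2 := mul_le_mul_of_nonneg_right h (sub_nonneg.2 (hx.1.trans hy.1).le)
  rcases min_lt_iff.1 hlt with h3 | h3
  · refine min_lt_iff.2 (Or.inl ?_); nlinarith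
  · refine min_lt_iff.2 (Or.inr ?_); nlinarith

/-- Joint measurability for Fubini: the set is open in the variables `(x, A)`, and `A = log τ` is
measurable. -/
theorem measurableSet_level {g : ℝ → ℝ} (hg : Integrable g) (a b T : ℝ) :
    MeasurableSet {q : ℝ × ℝ | q.2 ∈ Ioo 1 T ∧
      q.1 ∈ risingSet (levelPrim g a (Real.log q.2)) a b} := by
  have hopen : IsOpen {q : ℝ × ℝ | q.1 ∈ risingSet (levelPrim g a q.2) a b} := by
    have : {q : ℝ × ℝ | q.1 ∈ risingSet (levelPrim g a q.2) a b} =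
        {q | q.1 ∈ Ioo a b} ∩ ⋃ y ∈ Iio b,
          {q | q.1 < y ∧ min (levelPrim g a q.2 q.1) 0 < levelPrim g a q.2 y} := by
      ext q
      simp only [risingSet, mem_ofPred_eq, mem_inter_iff, mem_iUnion, mem_Iio, mem_Ioo]
      constructor
      · rintro ⟨h, y, hy, h'⟩; exact ⟨h, y, hy.2, hy.1, h'⟩
      · rintro ⟨h, y, hy, hy', h'⟩; exact ⟨h, y, ⟨hy', hy⟩, h'⟩
    rw [this]
    have hc := continuous_levelPrim hg a
    refine (isOpen_Ioo.preimage continuous_fst).inter (isOpen_biUnion fun y _ => ?_)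
    have h1 : IsOpen {q : ℝ × ℝ | q.1 < y} := isOpen_lt continuous_fst continuous_const
    refine h1.inter (t := {q | min (levelPrim g a q.2 q.1) 0 < levelPrim g a q.2 y})
      (isOpen_lt ?_ ?_)
    · exact (hc.comp (continuous_snd.prodMk continuous_fst)).min continuous_const
    · exact hc.comp (continuous_snd.prodMk continuous_const)
  exact (measurableSet_Ioo.preimage measurable_snd).inter
    (hopen.measurableSet.preimage (f := fun q : ℝ × ℝ => (q.1, Real.log q.2)) (by fun_prop))

theorem integrable_level {g : ℝ → ℝ} (hg : Integrable g) {p : ℝ} (hp : 1 ≤ p) (ε κ a b T : ℝ)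
    (hgp : IntegrableOn (fun x => |g x| ^ p) (Ioo a b)) :
    Integrable (fun q : ℝ × ℝ => |g q.1 - Real.log q.2| ^ p - ε + κ * (g q.1 - Real.log q.2))
      ((volume.restrict (Ioo a b)).prod (volume.restrict (Ioo 1 T))) := by
  have hlog : ∀ᵐ q ∂((volume.restrict (Ioo a b)).prod (volume.restrict (Ioo 1 T))),
      |Real.log q.2| ≤ |Real.log T| := by
    have h : ∀ᵐ τ ∂(volume.restrict (Ioo 1 T)), |Real.log τ| ≤ |Real.log T| := by
      refine (ae_restrict_iff' measurableSet_Ioo).2 (.of_forall fun τ hτ => ?_)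
      have h1 := Real.log_nonneg hτ.1.le
      have h2 := Real.log_le_log (by linarith [hτ.1]) hτ.2.le
      rw [abs_of_nonneg h1, abs_of_nonneg (h1.trans h2)]
      exact h2
    exact Measure.quasiMeasurePreserving_snd.ae h
  have hgm : AEStronglyMeasurable (fun q : ℝ × ℝ => g q.1)
      ((volume.restrict (Ioo a b)).prod (volume.restrict (Ioo 1 T))) :=
    hg.aestronglyMeasurable.restrict.comp_fst
  have hlm : AEStronglyMeasurable (fun q : ℝ × ℝ => Real.log q.2)
      ((volume.restrict (Ioo a b)).prod (volume.restrict (Ioo 1 T))) :=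
    Measurable.aestronglyMeasurable (by fun_prop)
  have hg1 : Integrable (fun q : ℝ × ℝ => g q.1)
      ((volume.restrict (Ioo a b)).prod (volume.restrict (Ioo 1 T))) :=
    hg.restrict.comp_fst _
  have hgp1 : Integrable (fun q : ℝ × ℝ => |g q.1| ^ p)
      ((volume.restrict (Ioo a b)).prod (volume.restrict (Ioo 1 T))) :=
    Integrable.comp_fst hgp _
  have hl1 : Integrable (fun q : ℝ × ℝ => Real.log q.2)
      ((volume.restrict (Ioo a b)).prod (volume.restrict (Ioo 1 T))) :=
    (integrable_const |Real.log T|).mono' hlm hlog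
  refine (Integrable.sub ?_ (integrable_const ε)).add ((hg1.sub hl1).const_mul κ)
  refine ((hgp1.add (integrable_const (|Real.log T| ^ p))).const_mul (2 ^ p)).mono' ?_ ?_
  · exact (Measurable.comp_aemeasurable (g := fun u : ℝ => |u| ^ p) (by fun_prop)
      (hgm.sub hlm).aemeasurable).aestronglyMeasurable
  · filter_upwards [hlog] with q hq
    rw [Real.norm_of_nonneg (by positivity)]
    refine (abs_add_rpow_le hp (g q.1) (-Real.log q.2)).trans ?_
    rw [abs_neg]
    simp only [Pi.add_apply]
    gcongr

theorem exists_integral_min_exp_le {p ε : ℝ} (hp : 1 ≤ p) (hε : 0 ≤ ε)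
    (hlt : ε < logMoment p 1) :
    ∃ C : ℝ, 0 ≤ C ∧ ∀ (g : ℝ → ℝ) (a b : ℝ), Integrable g → a < b → ∫ x in Ioo a b, g x = 0 →
      IntegrableOn (fun x => |g x| ^ p) (Ioo a b) →
      (∀ c d, a ≤ c → c < d → d ≤ b →
        ∫ x in Ioo c d, |g x - ⨍ y in Ioo c d, g y| ^ p ≤ ε * (d - c)) →
      ∀ T, 1 ≤ T → ∫ x in Ioo a b, min (Real.exp (g x)) T ≤ C * (b - a) := by
  obtain ⟨κ, C, hC, hlow⟩ := exists_level_integral_lower_bound hp hε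
  have hδ : 0 < logMoment p 1 - ε := by linarith
  refine ⟨C * (1 + ε) / (logMoment p 1 - ε), by positivity, ?_⟩
  intro g a b hg hab h0 hgp hosc T hT
  set μ := volume.restrict (Ioo a b) with hμ
  set ν := volume.restrict (Ioo 1 T) with hν
  set S : Set (ℝ × ℝ) := {q | q.2 ∈ Ioo 1 T ∧ q.1 ∈ risingSet (levelPrim g a (Real.log q.2)) a b}
    with hS
  have hSm : MeasurableSet S := measurableSet_level hg a b T
  set H : ℝ × ℝ → ℝ := fun q => |g q.1 - Real.log q.2| ^ p - ε + κ * (g q.1 - Real.log q.2) with hH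
  have hHi : Integrable H (μ.prod ν) := integrable_level hg hp ε κ a b T hgp
  have hK : Integrable (S.indicator H) (μ.prod ν) := hHi.indicator hSm
  have hle : ∫ x, ∫ τ, S.indicator H (x, τ) ∂ν ∂μ ≤ 0 := by
    rw [← integral_prod _ hK, integral_prod_symm _ hK]
    refine integral_nonpos_of_ae ((ae_restrict_iff' measurableSet_Ioo).2 (.of_forall fun τ hτ => ?_))
    have hF : Continuous (levelPrim g a (Real.log τ)) :=
      (continuous_levelPrim hg a).comp (continuous_const.prodMk continuous_id)
    have hEm := (isOpen_risingSet hF a b).measurableSet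
    have e : ∀ x, S.indicator H (x, τ) =
        (risingSet (levelPrim g a (Real.log τ)) a b).indicator (fun x => H (x, τ)) x := by
      intro x
      by_cases hx : x ∈ risingSet (levelPrim g a (Real.log τ)) a b
      · rw [indicator_of_mem hx, indicator_of_mem (show (x, τ) ∈ S from ⟨hτ, hx⟩)]
      · rw [indicator_of_notMem hx, indicator_of_notMem (fun h : (x, τ) ∈ S => hx h.2)]
    simp only [e, Pi.zero_apply]
    rw [hμ, setIntegral_indicator hEm,
      inter_eq_self_of_subset_right (show risingSet _ a b ⊆ Ioo a b from fun x hx => hx.1)]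
    exact setIntegral_level_nonpos hg hp hab (Real.log_nonneg hτ.1.le) h0 hgp hosc
  have hge : ∀ᵐ x ∂μ, (logMoment p 1 - ε) * min (Real.exp (g x)) T - C * (1 + |g x| ^ p) ≤
      ∫ τ, S.indicator H (x, τ) ∂ν := by
    have hL := ae_restrict_of_ae (s := Ioo a b) (LocallyIntegrable.ae_hasDerivAt_integral hg.locallyIntegrable)
    filter_upwards [hL, ae_restrict_mem measurableSet_Ioo] with x hx hxab
    set Z : Set ℝ := {τ | (x, τ) ∈ S} with hZ
    have hZm : MeasurableSet Z := hSm.preimage measurable_prodMk_left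
    have hbdd : BddAbove (insert 1 Z) := ⟨T, by
      rintro τ (rfl | h)
      · exact hT
      · exact h.1.2.le⟩
    set θ := sSup (insert 1 Z) with hθ
    have h1θ : 1 ≤ θ := le_csSup hbdd (mem_insert _ _)
    -- Rising sets shrink as the level grows, so the admissible `τ` form an interval starting at 1;
    -- inserting 1 in the supremum covers the case of no admissible `τ`.
    have hsub1 : Ioo 1 θ ⊆ Z := by
      intro τ hτ
      obtain ⟨τ', hτ', hlt'⟩ := exists_lt_of_lt_csSup (insert_nonempty 1 Z) hτ.2
      rcases hτ' with rfl | hτ'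
      · exact absurd hτ.1 (not_lt.2 hlt'.le)
      · exact ⟨⟨hτ.1, hlt'.trans hτ'.1.2⟩, risingSet_levelPrim_anti
          (Real.log_le_log (by linarith [hτ.1]) hlt'.le) hτ'.2⟩
    have hsub2 : Z ⊆ Ioc 1 θ := fun τ hτ => ⟨hτ.1.1, le_csSup hbdd (mem_insert_of_mem _ hτ)⟩
    have hZae : Z =ᵐ[volume] Ioc 1 θ := by
      refine Filter.EventuallyLE.antisymm (LE.le.eventuallyLE hsub2) ?_
      exact Ioo_ae_eq_Ioc.symm.le.trans (LE.le.eventuallyLE hsub1)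
    have hZT : Z ⊆ Ioo 1 T := fun τ hτ => hτ.1
    have hint : ∫ τ, S.indicator H (x, τ) ∂ν = ∫ τ in (1 : ℝ)..θ, H (x, τ) := by
      have e : ∀ τ, S.indicator H (x, τ) = Z.indicator (fun τ => H (x, τ)) τ := fun τ => rfl
      simp only [e]
      rw [hν, setIntegral_indicator hZm, inter_eq_self_of_subset_right hZT,
        setIntegral_congr_set hZae, intervalIntegral.integral_of_le h1θ]
    -- At a point of differentiability of the primitive every level `log τ' < g x` is admissible, as
    -- long as `τ'` lies between 1 and `T`.
    have hmin : min (Real.exp (g x)) T ≤ θ := by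
      refine le_of_forall_lt fun τ hτ => ?_
      by_contra! hle'
      obtain ⟨τ', h1, h2⟩ := exists_between hτ
      have h1' : 1 < τ' := (h1θ.trans hle').trans_lt h1
      have hmem : τ' ∈ Z := by
        refine ⟨⟨h1', h2.trans_le (min_le_right _ _)⟩, mem_risingSet_of_lt hxab ?_ (hx a)⟩
        exact (Real.log_lt_iff_lt_exp (by linarith)).2 (h2.trans_le (min_le_left _ _))
      linarith [(hsub2 hmem).2]
    rw [hint]
    have h2 := mul_le_mul_of_nonneg_left hmin hδ.le
    linarith [hlow (g x) θ h1θ]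
  have hvol : volume.real (Ioo a b) = b - a := by
    simp [Measure.real, Real.volume_Ioo, ENNReal.toReal_ofReal, hab.le]
  have hgp0 : ∫ x in Ioo a b, |g x| ^ p ≤ ε * (b - a) := by
    have := hosc a b le_rfl hab le_rfl
    rw [setAverage_eq, h0] at this
    simpa using this
  have hmi : Integrable (fun x => min (Real.exp (g x)) T) μ := by
    refine (integrable_const T).mono' ?_ (.of_forall fun x => ?_)
    · exact (Measurable.comp_aemeasurable (g := fun u : ℝ => min (Real.exp u) T) (by fun_prop)
        hg.aestronglyMeasurable.aemeasurable.restrict).aestronglyMeasurable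
    · rw [Real.norm_of_nonneg (le_min (Real.exp_pos _).le (by linarith))]
      exact min_le_right _ _
  have hgp1 : Integrable (fun x => 1 + |g x| ^ p) μ := (integrable_const (1 : ℝ)).add hgp
  have hfin := integral_mono_ae ((hmi.const_mul (logMoment p 1 - ε)).sub (hgp1.const_mul C))
    hK.integral_prod_left hge
  have hfin' := hfin.trans hle
  simp only [Pi.sub_apply] at hfin'
  rw [integral_sub (hmi.const_mul (logMoment p 1 - ε)) (hgp1.const_mul C), integral_const_mul,
    integral_const_mul, integral_add (integrable_const (1 : ℝ)) hgp] at hfin'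
  simp only [integral_const, smul_eq_mul, mul_one, hμ, measureReal_restrict_apply_univ, hvol] at hfin'
  rw [div_mul_eq_mul_div, le_div_iff₀ hδ]
  have := mul_le_mul_of_nonneg_left hgp0 hC
  linarith

/-! ### The John–Nirenberg threshold -/

theorem volume_real_Ioo_of_lt {a b : ℝ} (h : a < b) : volume.real (Ioo a b) = b - a := by
  simp [Measure.real, Real.volume_Ioo, ENNReal.toReal_ofReal, h.le]

theorem laverage_Ioo_le_iff {a b : ℝ} (h : a < b) (f : ℝ → ℝ≥0∞) (N : ℝ≥0∞) :
    ⨍⁻ t in Ioo a b, f t ∂volume ≤ N ↔ ∫⁻ t in Ioo a b, f t ≤ N * ENNReal.ofReal (b - a) := by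
  rw [setLAverage_eq, Real.volume_Ioo, ENNReal.div_le_iff (by simpa using h) ENNReal.ofReal_ne_top]

theorem laverage_le_of_bmoNorm_le {p : ℝ} (hp : 1 ≤ p) {Q : Set ℝ} {φ : ℝ → ℝ} {N : ℝ≥0∞}
    (h : bmoNorm p Q φ ≤ N) {a b : ℝ} (hJ : IsSubinterval Q a b) :
    ⨍⁻ t in Ioo a b, ENNReal.ofReal (|φ t - ⨍ s in Ioo a b, φ s| ^ p) ∂volume ≤ N ^ p := by
  have h1 : (⨍⁻ t in Ioo a b, ENNReal.ofReal (|φ t - ⨍ s in Ioo a b, φ s| ^ p) ∂volume) ^ (1 / p)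
      ≤ N := by
    refine le_trans ?_ h
    unfold bmoNorm
    exact le_iSup_of_le a (le_iSup_of_le b (le_iSup_of_le hJ le_rfl))
  rwa [one_div, ENNReal.rpow_inv_le_iff (by linarith)] at h1

theorem lintegral_exp_le_of_integral_min_exp_le {g : ℝ → ℝ} {s : Set ℝ} {M : ℝ}
    (hg : AEStronglyMeasurable g (volume.restrict s)) (hs : volume s ≠ ∞)
    (h : ∀ T, 1 ≤ T → ∫ x in s, min (Real.exp (g x)) T ≤ M) :
    ∫⁻ x in s, ENNReal.ofReal (Real.exp (g x)) ≤ ENNReal.ofReal M := by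
  have : IsFiniteMeasure (volume.restrict s) := ⟨by simpa [lt_top_iff_ne_top] using hs⟩
  have hm : ∀ T : ℝ, AEMeasurable (fun x => min (Real.exp (g x)) T) (volume.restrict s) := fun T =>
    Measurable.comp_aemeasurable (g := fun u : ℝ => min (Real.exp u) T) (by fun_prop)
      hg.aemeasurable
  have hsup : ∀ x, ENNReal.ofReal (Real.exp (g x)) =
      ⨆ n : ℕ, ENNReal.ofReal (min (Real.exp (g x)) (n + 1)) := by
    intro x
    apply le_antisymm
    · obtain ⟨n, hn⟩ := exists_nat_ge (Real.exp (g x))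
      refine le_iSup_of_le n (ENNReal.ofReal_le_ofReal (le_min le_rfl (by linarith)))
    · exact iSup_le fun n => ENNReal.ofReal_le_ofReal (min_le_left _ _)
  simp only [hsup]
  rw [lintegral_iSup' (fun n => (hm _).ennreal_ofReal)
    (.of_forall fun x i j hij => ENNReal.ofReal_le_ofReal (min_le_min_left _ (by
      have : (i : ℝ) ≤ j := by exact_mod_cast hij
      linarith)))]
  refine iSup_le fun n => ?_
  have hn : (1 : ℝ) ≤ n + 1 := by linarith [n.cast_nonneg (α := ℝ)]
  have hnn : ∀ x, 0 ≤ min (Real.exp (g x)) (n + 1) := fun x =>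
    le_min (Real.exp_pos _).le (by linarith)
  rw [← ofReal_integral_eq_lintegral_ofReal]
  · exact ENNReal.ofReal_le_ofReal (h _ hn)
  · refine (integrable_const ((n : ℝ) + 1)).mono' (hm _).aestronglyMeasurable (.of_forall fun x => ?_)
    rw [Real.norm_of_nonneg (hnn x)]
    exact min_le_right _ _
  · exact .of_forall hnn

/-- The integral John--Nirenberg inequality, with the sharp threshold. -/
theorem johnNirenbergBelow_logMoment {p : ℝ} (hp : 1 ≤ p) :
    JohnNirenbergBelow p (ENNReal.ofReal (logMoment p 1 ^ (1 / p))) := by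
  have hp0 : 0 < p := by linarith
  have hL := logMoment_one_pos hp
  intro ε hε
  obtain ⟨e, rfl⟩ : ∃ e : ℝ≥0, ε = e := ⟨ε.toNNReal, (ENNReal.coe_toNNReal hε.ne_top).symm⟩
  have he : (e : ℝ) ^ p < logMoment p 1 := by
    rw [← ENNReal.ofReal_coe_nnreal, ENNReal.ofReal_lt_ofReal_iff (Real.rpow_pos_of_pos hL _)] at hε
    have := Real.rpow_lt_rpow e.coe_nonneg hε hp0
    rwa [← Real.rpow_mul hL.le, one_div_mul_cancel hp0.ne', Real.rpow_one] at this
  obtain ⟨C, hC, hmain⟩ := exists_integral_min_exp_le hp (Real.rpow_nonneg e.coe_nonneg p) he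
  refine ⟨C.toNNReal, fun φ hφ hN a b hJ => ?_⟩
  have hab := hJ.1
  have hφi : IntegrableOn φ (Ioo a b) := hφ.1 a b hJ
  set m := ⨍ t in Ioo a b, φ t with hm
  -- Extension by zero makes `g` integrable on the line; only subintervals of `(a, b)` are tested,
  -- where it is `φ - m`.
  set g : ℝ → ℝ := (Ioo a b).indicator fun x => φ x - m with hg
  have hgi : Integrable g :=
    (integrable_indicator_iff measurableSet_Ioo).2 (hφi.sub (integrable_const m))
  have hgeq : ∀ c d, a ≤ c → d ≤ b → ∀ x ∈ Ioo c d, g x = φ x - m := fun c d hc hd x hx =>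
    indicator_of_mem (Ioo_subset_Ioo hc hd hx) _
  have hav : ∀ c d, a ≤ c → c < d → d ≤ b →
      ⨍ x in Ioo c d, g x = (⨍ x in Ioo c d, φ x) - m := by
    intro c d hc hcd hd
    have hi := hφi.mono_set (Ioo_subset_Ioo hc hd)
    rw [setAverage_eq, setAverage_eq, setIntegral_congr_fun measurableSet_Ioo (hgeq c d hc hd),
      integral_sub hi (integrable_const m)]
    have : d - c ≠ 0 := by linarith
    simp only [integral_const, smul_eq_mul, measureReal_restrict_apply_univ,
      volume_real_Ioo_of_lt hcd]
    field_simp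
  have hosc : ∀ c d, a ≤ c → c < d → d ≤ b →
      IntegrableOn (fun x => |g x - ⨍ y in Ioo c d, g y| ^ p) (Ioo c d) ∧
      ∫ x in Ioo c d, |g x - ⨍ y in Ioo c d, g y| ^ p ≤ (e : ℝ) ^ p * (d - c) := by
    intro c d hc hcd hd
    have h1 := (laverage_Ioo_le_iff hcd _ _).1 (laverage_le_of_bmoNorm_le hp hN
      (⟨hcd, (Ioo_subset_Ioo hc hd).trans hJ.2⟩ : IsSubinterval (Ioo 0 1) c d))
    have h2 : ∫⁻ x in Ioo c d, ENNReal.ofReal (|g x - ⨍ y in Ioo c d, g y| ^ p) ≤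
        ENNReal.ofReal ((e : ℝ) ^ p * (d - c)) := by
      rw [hav c d hc hcd hd, ENNReal.ofReal_mul (by positivity),
        ← ENNReal.ofReal_rpow_of_nonneg e.coe_nonneg hp0.le, ENNReal.ofReal_coe_nnreal]
      refine le_trans (le_of_eq (setLIntegral_congr_fun measurableSet_Ioo fun x hx => ?_)) h1
      rw [hgeq c d hc hd x hx, sub_sub_sub_cancel_right]
    have hmeas : AEStronglyMeasurable (fun x => |g x - ⨍ y in Ioo c d, g y| ^ p)
        (volume.restrict (Ioo c d)) :=
      (Measurable.comp_aemeasurable (g := fun u : ℝ => |u - ⨍ y in Ioo c d, g y| ^ p)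
        (by fun_prop) hgi.aestronglyMeasurable.aemeasurable.restrict).aestronglyMeasurable
    have hnn : ∀ x, 0 ≤ |g x - ⨍ y in Ioo c d, g y| ^ p := fun x => by positivity
    refine ⟨⟨hmeas, ?_⟩, ?_⟩
    · rw [hasFiniteIntegral_iff_ofReal (.of_forall hnn)]
      exact h2.trans_lt ENNReal.ofReal_lt_top
    · rw [integral_eq_lintegral_of_nonneg_ae (.of_forall hnn) hmeas]
      refine ENNReal.toReal_le_of_le_ofReal ?_ h2
      exact mul_nonneg (by positivity) (by linarith)
  have h0 : ∫ x in Ioo a b, g x = 0 := by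
    have h := hav a b le_rfl hab le_rfl
    rw [← hm, sub_self, setAverage_eq, volume_real_Ioo_of_lt hab, smul_eq_mul, mul_eq_zero] at h
    exact h.resolve_left (inv_ne_zero (by linarith))
  have hgp : IntegrableOn (fun x => |g x| ^ p) (Ioo a b) := by
    have := (hosc a b le_rfl hab le_rfl).1
    rw [hav a b le_rfl hab le_rfl, ← hm, sub_self] at this
    simpa using this
  have hfin := lintegral_exp_le_of_integral_min_exp_le (s := Ioo a b)
    hgi.aestronglyMeasurable.restrict (by simp [Real.volume_Ioo])
    (hmain g a b hgi hab h0 hgp fun c d hc hcd hd => (hosc c d hc hcd hd).2)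
  rw [laverage_Ioo_le_iff hab]
  have e1 : ∫⁻ t in Ioo a b, ENNReal.ofReal (Real.exp (φ t)) =
      (∫⁻ t in Ioo a b, ENNReal.ofReal (Real.exp (g t))) * ENNReal.ofReal (Real.exp m) := by
    rw [← lintegral_mul_const' _ _ ENNReal.ofReal_ne_top]
    refine setLIntegral_congr_fun measurableSet_Ioo fun x hx => ?_
    rw [hgeq a b le_rfl le_rfl x hx, ← ENNReal.ofReal_mul (Real.exp_pos _).le, ← Real.exp_add,
      sub_add_cancel]
  rw [e1]
  refine (mul_le_mul_left hfin _).trans (le_of_eq ?_)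
  rw [ENNReal.ofReal_mul hC]
  change ENNReal.ofReal C * _ * _ = ENNReal.ofReal C * _ * _
  ring

/-! ### Affine changes of variable -/

theorem measurableEmbedding_affine (a : ℝ) {r : ℝ} (hr : 0 < r) :
    MeasurableEmbedding fun s : ℝ => a + r * s :=
  (measurableEmbedding_addLeft a).comp (measurableEmbedding_mulLeft₀ hr.ne')

theorem map_affine_restrict_Ioo (a : ℝ) {r : ℝ} (hr : 0 < r) (c d : ℝ) :
    Measure.map (fun s : ℝ => a + r * s) (volume.restrict (Ioo c d)) =
      ENNReal.ofReal r⁻¹ • volume.restrict (Ioo (a + r * c) (a + r * d)) := by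
  have h1 : Measure.map (fun s : ℝ => a + r * s) volume = ENNReal.ofReal r⁻¹ • volume := by
    have : (fun s : ℝ => a + r * s) = (fun x => a + x) ∘ fun s => r * s := rfl
    rw [this, ← Measure.map_map (by fun_prop) (by fun_prop), Real.map_volume_mul_left hr.ne',
      Measure.map_smul, map_add_left_eq_self, abs_of_pos (inv_pos.2 hr)]
  have h2 : (fun s : ℝ => a + r * s) ⁻¹' Ioo (a + r * c) (a + r * d) = Ioo c d := by
    ext s
    simp [hr]
  rw [← h2, ← (measurableEmbedding_affine a hr).restrict_map, h1, Measure.restrict_smul]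

theorem laverage_comp_affine (a : ℝ) {r : ℝ} (hr : 0 < r) (c d : ℝ) (f : ℝ → ℝ≥0∞) :
    ⨍⁻ s in Ioo c d, f (a + r * s) ∂volume = ⨍⁻ t in Ioo (a + r * c) (a + r * d), f t ∂volume := by
  have hr' : ENNReal.ofReal r⁻¹ ≠ 0 := by simpa using hr
  rw [setLAverage_eq, setLAverage_eq, ← (measurableEmbedding_affine a hr).lintegral_map,
    map_affine_restrict_Ioo a hr, lintegral_smul_measure, Real.volume_Ioo, Real.volume_Ioo,
    show d - c = r⁻¹ * (a + r * d - (a + r * c)) by field_simp; ring,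
    ENNReal.ofReal_mul (inv_pos.2 hr).le, smul_eq_mul,
    ENNReal.mul_div_mul_left _ _ hr' ENNReal.ofReal_ne_top]

theorem average_comp_affine (a : ℝ) {r : ℝ} (hr : 0 < r) {c d : ℝ} (hcd : c < d) (f : ℝ → ℝ) :
    ⨍ s in Ioo c d, f (a + r * s) = ⨍ t in Ioo (a + r * c) (a + r * d), f t := by
  have h : a + r * c < a + r * d := by gcongr
  rw [setAverage_eq, setAverage_eq, ← (measurableEmbedding_affine a hr).integral_map,
    map_affine_restrict_Ioo a hr, integral_smul_measure, volume_real_Ioo_of_lt hcd,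
    volume_real_Ioo_of_lt h, ENNReal.toReal_ofReal (inv_pos.2 hr).le, smul_smul]
  congr 1
  rw [show a + r * d - (a + r * c) = r * (d - c) by ring, mul_inv]
  ring

theorem integrableOn_comp_affine (a : ℝ) {r : ℝ} (hr : 0 < r) {c d : ℝ} {f : ℝ → ℝ}
    (hf : IntegrableOn f (Ioo (a + r * c) (a + r * d))) :
    IntegrableOn (fun s => f (a + r * s)) (Ioo c d) := by
  have := (measurableEmbedding_affine a hr).integrable_map_iff (μ := volume.restrict (Ioo c d))
    (g := f)
  refine this.1 ?_
  rw [map_affine_restrict_Ioo a hr]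
  exact Integrable.smul_measure hf ENNReal.ofReal_ne_top

theorem average_const_mul (c a b : ℝ) (g : ℝ → ℝ) :
    ⨍ t in Ioo a b, c * g t = c * ⨍ t in Ioo a b, g t := by
  simp only [setAverage_eq, integral_const_mul, smul_eq_mul]
  ring

/-- The image of a subinterval of `(0, 1)` under the affine map onto a subinterval of `Q`. -/
theorem IsSubinterval.affine {Q : Set ℝ} {a b c d : ℝ} (hJ : IsSubinterval Q a b)
    (h : IsSubinterval (Ioo 0 1) c d) :
    IsSubinterval Q (a + (b - a) * c) (a + (b - a) * d) := by
  have hr : 0 < b - a := sub_pos.2 hJ.1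
  have h1 := closure_mono h.2
  rw [closure_Ioo h.1.ne, closure_Ioo zero_ne_one] at h1
  have hc := (h1 ⟨le_rfl, h.1.le⟩).1
  have hd := (h1 ⟨h.1.le, le_rfl⟩).2
  refine ⟨by nlinarith [h.1], (Ioo_subset_Ioo ?_ ?_).trans hJ.2⟩
  · nlinarith
  · nlinarith

theorem bmoNorm_mul_comp_affine_le {p : ℝ} (hp : 1 ≤ p) {Q : Set ℝ} {a b : ℝ}
    (hJ : IsSubinterval Q a b) (k : ℝ) (g : ℝ → ℝ) :
    bmoNorm p (Ioo 0 1) (fun s => k * g (a + (b - a) * s)) ≤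
      ENNReal.ofReal |k| * bmoNorm p Q g := by
  have hp0 : 0 < p := by linarith
  have hr : 0 < b - a := sub_pos.2 hJ.1
  rw [bmoNorm]
  refine iSup_le fun c => iSup_le fun d => iSup_le fun h => ?_
  have h1 := laverage_le_of_bmoNorm_le hp (le_refl (bmoNorm p Q g)) (hJ.affine h)
  rw [one_div, ENNReal.rpow_inv_le_iff hp0, average_const_mul, average_comp_affine a hr h.1 g]
  set m := ⨍ t in Ioo (a + (b - a) * c) (a + (b - a) * d), g t
  have e : ∀ s, ENNReal.ofReal (|k * g (a + (b - a) * s) - k * m| ^ p) =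
      ENNReal.ofReal |k| ^ p * ENNReal.ofReal (|g (a + (b - a) * s) - m| ^ p) := by
    intro s
    rw [← mul_sub, abs_mul, Real.mul_rpow (abs_nonneg _) (abs_nonneg _),
      ENNReal.ofReal_mul (by positivity), ENNReal.ofReal_rpow_of_nonneg (abs_nonneg _) hp0.le]
  simp only [e]
  rw [ENNReal.mul_rpow_of_nonneg _ _ hp0.le, setLAverage_eq,
    lintegral_const_mul' _ _ (ENNReal.rpow_ne_top_of_nonneg hp0.le ENNReal.ofReal_ne_top),
    mul_div_assoc, ← setLAverage_eq,
    laverage_comp_affine a hr c d (fun t => ENNReal.ofReal (|g t - m| ^ p))]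
  gcongr

/-- Each subinterval of `Q` is rescaled to `(0, 1)`, which does not increase the norm; hence one
constant serves all of them, and `Q` may be unbounded. -/
theorem laverage_exp_le {p : ℝ} (hp : 1 ≤ p) {Q : Set ℝ} {g : ℝ → ℝ} (hg : LocIntegrable Q g)
    {k : ℝ} (h : ENNReal.ofReal |k| * bmoNorm p Q g < johnNirenbergConst p) :
    ∃ C : ℝ≥0, ∀ a b, IsSubinterval Q a b →
      ⨍⁻ t in Ioo a b, ENNReal.ofReal (Real.exp (k * g t)) ∂volume ≤
        C * ENNReal.ofReal (Real.exp (k * ⨍ t in Ioo a b, g t)) := by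
  obtain ⟨ε₀, hε₀, hlt⟩ := lt_sSup_iff.1 h
  obtain ⟨C, hC⟩ := hε₀ _ hlt
  refine ⟨C, fun a b hJ => ?_⟩
  have hr : 0 < b - a := sub_pos.2 hJ.1
  have hle := bmoNorm_mul_comp_affine_le hp hJ k g
  have hmem : MemBMO p (Ioo 0 1) (fun s => k * g (a + (b - a) * s)) :=
    ⟨fun c d h => (integrableOn_comp_affine a hr (hg _ _ (hJ.affine h))).const_mul k,
      (hle.trans_lt hlt).trans_le le_top⟩
  have := hC _ hmem hle 0 1 ⟨one_pos, le_rfl⟩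
  rw [average_const_mul, average_comp_affine a hr one_pos g,
    laverage_comp_affine a hr 0 1 (fun t => ENNReal.ofReal (Real.exp (k * g t)))] at this
  simpa using this

/-! ### Bounded perturbations and the lower bound -/

theorem ae_bound_of_memLp_top {Q : Set ℝ} {f : ℝ → ℝ} (hf : MemLp f ∞ (volume.restrict Q)) :
    ∃ K : ℝ, 0 ≤ K ∧ ∀ᵐ t ∂(volume.restrict Q), |f t| ≤ K := by
  have h := hf.2
  rw [eLpNorm_exponent_top] at h
  refine ⟨(eLpNormEssSup f (volume.restrict Q)).toReal, ENNReal.toReal_nonneg, ?_⟩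
  filter_upwards [ae_le_eLpNormEssSup (f := f) (μ := volume.restrict Q)] with t ht
  rw [← Real.norm_eq_abs, ← toReal_enorm]
  exact ENNReal.toReal_mono h.ne ht

/-- Exponentials of functions that are close to `L^∞` are `A_∞` weights. -/
theorem memAInfty_exp_of_lt {p : ℝ} (hp : 1 ≤ p) {Q : Set ℝ} {φ f : ℝ → ℝ}
    (hφ : LocIntegrable Q φ) (hf : MemLp f ∞ (volume.restrict Q)) {k : ℝ}
    (h : ENNReal.ofReal |k| * bmoNorm p Q (fun t => φ t - f t) < johnNirenbergConst p) :
    MemAInfty Q (fun t => Real.exp (k * φ t)) := by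
  obtain ⟨K, hK0, hK⟩ := ae_bound_of_memLp_top hf
  have hKJ : ∀ a b, IsSubinterval Q a b → ∀ᵐ t ∂(volume.restrict (Ioo a b)), |f t| ≤ K :=
    fun a b hJ => ae_restrict_of_ae_restrict_of_subset hJ.2 hK
  have hfi : LocIntegrable Q f := fun a b hJ =>
    (integrable_const K).mono' (hf.1.mono_measure (Measure.restrict_mono hJ.2 le_rfl)) (hKJ a b hJ)
  have hsub : LocIntegrable Q fun t => φ t - f t := fun a b hJ => (hφ a b hJ).sub (hfi a b hJ)
  obtain ⟨C, hC⟩ := laverage_exp_le hp hsub h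
  -- One factor `exp (|k| * K)` comes from restoring `f` inside the integral, the other from
  -- restoring its average.
  set D : ℝ≥0∞ := C * ENNReal.ofReal (Real.exp (2 * (|k| * K))) with hD
  have hDtop : D < ∞ := ENNReal.mul_lt_top ENNReal.coe_lt_top ENNReal.ofReal_lt_top
  have main : ∀ a b, IsSubinterval Q a b →
      ⨍⁻ t in Ioo a b, ENNReal.ofReal (Real.exp (k * φ t)) ∂volume ≤
        D * ENNReal.ofReal (Real.exp (k * ⨍ t in Ioo a b, φ t)) := by
    intro a b hJ
    have hb := hJ.1
    have h1 := (laverage_Ioo_le_iff hb _ _).1 (hC a b hJ)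
    rw [laverage_Ioo_le_iff hb]
    have hav : k * ⨍ t in Ioo a b, (φ t - f t) ≤ k * (⨍ t in Ioo a b, φ t) + |k| * K := by
      have hfb : |⨍ t in Ioo a b, f t| ≤ K := by
        have := norm_setIntegral_le_of_norm_le_const_ae (μ := volume) (s := Ioo a b) (f := f)
          (by simp [Real.volume_Ioo]) (hKJ a b hJ)
        rw [volume_real_Ioo_of_lt hb, Real.norm_eq_abs] at this
        rw [setAverage_eq, volume_real_Ioo_of_lt hb, smul_eq_mul, abs_mul,
          abs_of_pos (inv_pos.2 (sub_pos.2 hb)), inv_mul_le_iff₀ (sub_pos.2 hb), mul_comm]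
        exact this
      have e : ⨍ t in Ioo a b, (φ t - f t) = (⨍ t in Ioo a b, φ t) - ⨍ t in Ioo a b, f t := by
        simp only [setAverage_eq]
        rw [integral_sub (hφ a b hJ) (hfi a b hJ), smul_sub]
      have h2 : |k * ⨍ t in Ioo a b, f t| ≤ |k| * K := by
        rw [abs_mul]; gcongr
      rw [e, mul_sub]
      linarith [(abs_le.1 h2).1]
    calc ∫⁻ t in Ioo a b, ENNReal.ofReal (Real.exp (k * φ t))
        ≤ ∫⁻ t in Ioo a b, ENNReal.ofReal (Real.exp (|k| * K)) *
            ENNReal.ofReal (Real.exp (k * (φ t - f t))) := by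
          refine lintegral_mono_ae ?_
          filter_upwards [hKJ a b hJ] with t ht
          rw [← ENNReal.ofReal_mul (Real.exp_pos _).le, ← Real.exp_add]
          refine ENNReal.ofReal_le_ofReal (Real.exp_le_exp.2 ?_)
          have h2 : |k * f t| ≤ |k| * K := by rw [abs_mul]; gcongr
          linarith [(abs_le.1 h2).2]
      _ = ENNReal.ofReal (Real.exp (|k| * K)) *
            ∫⁻ t in Ioo a b, ENNReal.ofReal (Real.exp (k * (φ t - f t))) :=
          lintegral_const_mul' _ _ ENNReal.ofReal_ne_top
      _ ≤ ENNReal.ofReal (Real.exp (|k| * K)) * (C * ENNReal.ofReal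
            (Real.exp (k * (⨍ t in Ioo a b, φ t) + |k| * K)) * ENNReal.ofReal (b - a)) := by
          gcongr
          refine h1.trans ?_
          gcongr
      _ = _ := by
          rw [hD, Real.exp_add, ENNReal.ofReal_mul (Real.exp_pos _).le, two_mul, Real.exp_add,
            ENNReal.ofReal_mul (Real.exp_pos _).le]
          ring
  refine ⟨.of_forall fun t => Real.exp_pos _, fun a b hJ => ⟨?_, ?_⟩, fun a b hJ => ?_, ?_⟩
  · exact (Measurable.comp_aemeasurable (g := fun u : ℝ => Real.exp (k * u)) (by fun_prop)
      (hφ a b hJ).aestronglyMeasurable.aemeasurable).aestronglyMeasurable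
  · rw [hasFiniteIntegral_iff_ofReal (.of_forall fun t => (Real.exp_pos _).le)]
    refine ((laverage_Ioo_le_iff hJ.1 _ _).1 (main a b hJ)).trans_lt ?_
    exact ENNReal.mul_lt_top (ENNReal.mul_lt_top hDtop ENNReal.ofReal_lt_top) ENNReal.ofReal_lt_top
  · simp only [Real.log_exp]
    exact (hφ a b hJ).const_mul k
  · refine lt_of_le_of_lt ?_ hDtop
    refine iSup_le fun a => iSup_le fun b => iSup_le fun hJ => ?_
    simp only [Real.log_exp]
    rw [average_const_mul]
    refine (mul_le_mul_left (main a b hJ) _).trans (le_of_eq ?_)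
    rw [mul_assoc, ← ENNReal.ofReal_mul (Real.exp_pos _).le, ← Real.exp_add, add_neg_cancel]
    simp

theorem le_epsSup {Q : Set ℝ} {φ : ℝ → ℝ} {ε : ℝ} (hε : 0 < ε)
    (h : MemAInfty Q (fun t => Real.exp (ε * φ t))) : ENNReal.ofReal ε ≤ epsSup Q φ := by
  unfold epsSup
  exact le_iSup_of_le ε (le_iSup_of_le hε (le_iSup_of_le h le_rfl))

theorem le_min_epsSup {p : ℝ} (hp : 1 ≤ p) {Q : Set ℝ} {φ f : ℝ → ℝ}
    (hφ : LocIntegrable Q φ) (hf : MemLp f ∞ (volume.restrict Q)) {ε : ℝ} (hε : 0 < ε)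
    (h : ENNReal.ofReal ε * bmoNorm p Q (fun t => φ t - f t) < johnNirenbergConst p) :
    ENNReal.ofReal ε ≤ min (epsSup Q φ) (epsSup Q fun t => -φ t) := by
  refine le_min (le_epsSup hε ?_) (le_epsSup hε ?_)
  · exact memAInfty_exp_of_lt hp hφ hf (by rwa [abs_of_pos hε])
  · simp only [mul_neg, ← neg_mul]
    exact memAInfty_exp_of_lt hp hφ hf (by rwa [abs_neg, abs_of_pos hε])

/-- The lower bound for the distance to `L^∞`. -/
theorem div_min_epsSup_le_bmoDistLInfty {p : ℝ} (hp : 1 ≤ p) {Q : Set ℝ} {φ : ℝ → ℝ}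
    (hφ : LocIntegrable Q φ) :
    johnNirenbergConst p / min (epsSup Q φ) (epsSup Q fun t => -φ t) ≤ bmoDistLInfty p Q φ := by
  refine le_iInf fun f => le_iInf fun hf => ?_
  set N := bmoNorm p Q fun t => φ t - f t with hN
  set m := min (epsSup Q φ) (epsSup Q fun t => -φ t) with hm
  by_cases hmt : m = ∞
  · simp [hmt]
  by_cases hNt : N = ∞
  · simp [hNt]
  have key : johnNirenbergConst p ≤ N * m := by
    have h1 : ∀ x : ℝ≥0, m < x → johnNirenbergConst p ≤ N * x := by
      intro x hx
      by_contra! hlt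
      have hx0 : (0 : ℝ) < x := by
        have : (0 : ℝ≥0∞) < x := lt_of_le_of_lt zero_le hx
        exact_mod_cast this
      have := le_min_epsSup hp hφ hf hx0 (by rwa [ENNReal.ofReal_coe_nnreal, mul_comm])
      rw [ENNReal.ofReal_coe_nnreal] at this
      exact absurd this (not_le.2 hx)
    refine ENNReal.le_of_forall_pos_le_add fun δ hδ _ => ?_
    obtain ⟨N', hN'⟩ : ∃ N' : ℝ≥0, N = N' := ⟨N.toNNReal, (ENNReal.coe_toNNReal hNt).symm⟩
    obtain ⟨m', hm'⟩ : ∃ m' : ℝ≥0, m = m' := ⟨m.toNNReal, (ENNReal.coe_toNNReal hmt).symm⟩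
    rw [hN', hm'] at h1 ⊢
    -- Dividing by `N' + 1` rather than `N'` allows `N' = 0`; the excess is still at most `δ`.
    have h2 := h1 (m' + δ / (N' + 1)) (by
      have : 0 < δ / (N' + 1) := by positivity
      exact_mod_cast lt_add_of_pos_right m' this)
    refine h2.trans ?_
    have h3 : N' * (m' + δ / (N' + 1)) ≤ N' * m' + δ := by
      rw [mul_add]
      gcongr
      rw [mul_div_left_comm]
      refine mul_le_of_le_one_right zero_le ?_
      exact div_le_one_of_le₀ (le_add_of_nonneg_right zero_le) zero_le
    exact_mod_cast h3
  exact ENNReal.div_le_of_le_mul key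

/-! ### Oscillation of the logarithm -/

/-- Moving away from `y₀`, a convex function grows at least at the rate of its support slope there:
`F x - k x` is convex with minimum at `y₀`, and `y` lies between `y₀` and `y + z`. -/
theorem ConvexOn.add_support_slope_mul_le {F : ℝ → ℝ} (hF : ConvexOn ℝ univ F) {y₀ k y z : ℝ}
    (hk : ∀ x, F y₀ + k * (x - y₀) ≤ F x) (h : 0 ≤ (y - y₀) * z) : F y + k * z ≤ F (y + z) := by
  have hG : ConvexOn ℝ univ (fun x => F x + (-k) * x) :=
    hF.add ((LinearMap.mul ℝ ℝ (-k)).convexOn convex_univ)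
  have hy₀ := hk (y + z)
  rcases lt_trichotomy z 0 with hz | rfl | hz
  · have : y ≤ y₀ := by nlinarith
    have := hG.le_max_of_mem_Icc (mem_univ (y + z)) (mem_univ y₀) (z := y) ⟨by linarith, this⟩
    rcases le_max_iff.1 this with h | h <;> linarith
  · simp
  · have : y₀ ≤ y := by nlinarith
    have := hG.le_max_of_mem_Icc (mem_univ y₀) (mem_univ (y + z)) (z := y) ⟨this, by linarith⟩
    rcases le_max_iff.1 this with h | h <;> linarith

theorem intervalIntegrable_log_affine (a r : ℝ) (hr : 0 < r) :
    IntervalIntegrable (fun s => Real.log (a + r * s)) volume 0 1 := by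
  rw [intervalIntegrable_iff_integrableOn_Ioo_of_le zero_le_one]
  refine integrableOn_comp_affine a hr ?_
  rw [← intervalIntegrable_iff_integrableOn_Ioo_of_le (by linarith)]
  exact intervalIntegral.intervalIntegrable_log'

theorem integral_log_affine (a r : ℝ) (hr : 0 < r) :
    r * (1 + ∫ s in (0 : ℝ)..1, Real.log (a + r * s)) =
      (a + r) * Real.log (a + r) - a * Real.log a := by
  rw [intervalIntegral.integral_comp_add_mul (fun x => Real.log x) hr.ne', mul_zero, mul_one,
    add_zero, integral_log, smul_eq_mul, mul_add, mul_inv_cancel_left₀ hr.ne']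
  ring

/-- The oscillation of the logarithm on `(a, a + r)` is at most its oscillation on `(0, 1)`. -/
theorem lintegral_log_affine_osc_le {p a r : ℝ} (hp : 1 ≤ p) (ha : 0 ≤ a) (hr : 0 < r) :
    ∫⁻ s in Ioo 0 1, ENNReal.ofReal (|Real.log (a + r * s) -
      ∫ s in (0 : ℝ)..1, Real.log (a + r * s)| ^ p) ≤ ENNReal.ofReal (logMoment p 1) := by
  set m := ∫ s in (0 : ℝ)..1, Real.log (a + r * s) with hm
  have hm1 : r * (1 + m) = (a + r) * Real.log (a + r) - a * Real.log a := integral_log_affine a r hr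
  -- `Y` and the difference `Z` between the centred logarithm and `Y` are both nondecreasing with
  -- mean zero. Thus `Z` has the sign of `Y - Y s₀` for a zero `s₀` of `Z`, and the support
  -- inequality integrates to the claim.
  set Y : ℝ → ℝ := fun s => Real.log (a + r * s) - m with hY
  set Z : ℝ → ℝ := fun s => Real.log s + 1 - Y s with hZ
  have hpos : ∀ s, 0 < s → 0 < a + r * s := fun s hs => by positivity
  have hYmono : ∀ s t, 0 < s → s ≤ t → Y s ≤ Y t := fun s t hs hst =>
    sub_le_sub_right (Real.log_le_log (hpos s hs) (by gcongr)) _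
  have hZmono : ∀ s t, 0 < s → s ≤ t → Z s ≤ Z t := by
    intro s t hs hst
    have ht := hs.trans_le hst
    have h : Real.log s + Real.log (a + r * t) ≤ Real.log t + Real.log (a + r * s) := by
      rw [← Real.log_mul hs.ne' (hpos t ht).ne', ← Real.log_mul ht.ne' (hpos s hs).ne']
      refine Real.log_le_log (mul_pos hs (hpos t ht)) ?_
      nlinarith
    simp only [hZ, hY]
    linarith
  obtain ⟨s₀, hs₀, hZ₀⟩ : ∃ s₀, 0 < s₀ ∧ Z s₀ = 0 := by
    rcases ha.eq_or_lt with rfl | ha'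
    · refine ⟨1, one_pos, ?_⟩
      have : 1 + m = Real.log r := by
        simp only [zero_add, zero_mul, sub_zero] at hm1
        exact mul_left_cancel₀ hr.ne' hm1
      simp only [hZ, hY, Real.log_one, mul_one, zero_add]
      linarith
    · have h1 : Real.log (a + r) ≤ 1 + m := by
        have : Real.log a ≤ Real.log (a + r) := Real.log_le_log ha' (by linarith)
        have : r * Real.log (a + r) ≤ r * (1 + m) := by rw [hm1]; nlinarith
        exact le_of_mul_le_mul_left this hr
      have h2 : a + r ≤ Real.exp (1 + m) := (Real.log_le_iff_le_exp (by linarith)).1 h1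
      have h3 : 0 < Real.exp (1 + m) - r := by linarith
      -- This solves `s * exp (1 + m) = a + r * s`, which is `Z s = 0`. It need not lie in `(0, 1)`,
      -- since the monotonicity holds on all positive `s`.
      refine ⟨a / (Real.exp (1 + m) - r), by positivity, ?_⟩
      have h4 : a + r * (a / (Real.exp (1 + m) - r)) =
          Real.exp (1 + m) * (a / (Real.exp (1 + m) - r)) := by
        field_simp
        ring
      simp only [hZ, hY]
      rw [h4, Real.log_mul (Real.exp_pos _).ne' (by positivity), Real.log_exp]
      ring
  obtain ⟨k, hk⟩ := (convexOn_abs_rpow hp).exists_support_slope (Y s₀)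
  have hpt : ∀ s, 0 < s → |Y s| ^ p ≤ |Real.log s + 1| ^ p - k * Z s := by
    intro s hs
    have hsign : 0 ≤ (Y s - Y s₀) * Z s := by
      rcases le_total s s₀ with h | h
      · exact mul_nonneg_of_nonpos_of_nonpos (sub_nonpos.2 (hYmono _ _ hs h))
          (hZ₀ ▸ hZmono _ _ hs h)
      · exact mul_nonneg (sub_nonneg.2 (hYmono _ _ hs₀ h)) (hZ₀ ▸ hZmono _ _ hs₀ h)
    have := (convexOn_abs_rpow hp).add_support_slope_mul_le hk hsign
    rw [show Y s + Z s = Real.log s + 1 by simp only [hZ]; ring] at this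
    linarith
  have hYi : IntervalIntegrable Y volume 0 1 :=
    (intervalIntegrable_log_affine a r hr).sub intervalIntegrable_const
  have hli : IntervalIntegrable (fun s => Real.log s + 1) volume 0 1 :=
    intervalIntegral.intervalIntegrable_log'.add intervalIntegrable_const
  have hZi : IntervalIntegrable Z volume 0 1 := hli.sub hYi
  have hZ0 : ∫ s in (0 : ℝ)..1, Z s = 0 := by
    rw [intervalIntegral.integral_sub hli hYi, intervalIntegral.integral_sub
      (intervalIntegrable_log_affine a r hr) intervalIntegrable_const,
      intervalIntegral.integral_add intervalIntegral.intervalIntegrable_log'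
      intervalIntegrable_const, integral_log_zero_one, ← hm]
    simp
  have hRi : IntervalIntegrable (fun s => |Real.log s + 1| ^ p - k * Z s) volume 0 1 :=
    (intervalIntegrable_logMoment hp 1).sub (hZi.const_mul k)
  have hR : ∫ s in Ioo (0 : ℝ) 1, (|Real.log s + 1| ^ p - k * Z s) = logMoment p 1 := by
    rw [← integral_Ioc_eq_integral_Ioo, ← intervalIntegral.integral_of_le zero_le_one,
      intervalIntegral.integral_sub (intervalIntegrable_logMoment hp 1) (hZi.const_mul k),
      intervalIntegral.integral_const_mul, hZ0, logMoment]
    simp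
  rw [← hR, ofReal_integral_eq_lintegral_ofReal
    ((intervalIntegrable_iff_integrableOn_Ioo_of_le zero_le_one).1 hRi)
    ((ae_restrict_iff' measurableSet_Ioo).2 (.of_forall fun s hs =>
      (Real.rpow_nonneg (abs_nonneg _) p).trans (hpt s hs.1)))]
  exact setLIntegral_mono' measurableSet_Ioo fun s hs => ENNReal.ofReal_le_ofReal (hpt s hs.1)

theorem average_Ioo_zero_one (f : ℝ → ℝ) : ⨍ s in Ioo 0 1, f s = ∫ s in (0 : ℝ)..1, f s := by
  rw [setAverage_eq, volume_real_Ioo_of_lt one_pos, intervalIntegral.integral_of_le zero_le_one,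
    integral_Ioc_eq_integral_Ioo]
  simp

/-! ### The extremal function -/

theorem le_of_isSubinterval_of_bddBelow {Q : Set ℝ} (hQ : BddBelow Q) {a b : ℝ}
    (hJ : IsSubinterval Q a b) : sInf Q ≤ a := by
  refine le_of_forall_gt_imp_ge_of_dense fun t ht => ?_
  rcases lt_or_ge t b with h | h
  · exact csInf_le hQ (hJ.2 ⟨ht, h⟩)
  · obtain ⟨u, hu⟩ := nonempty_Ioo.2 hJ.1
    exact (csInf_le hQ (hJ.2 hu)).trans (hu.2.le.trans h)

theorem bmoNorm_neg_log_le {p : ℝ} (hp : 1 ≤ p) {Q : Set ℝ} (hQ : BddBelow Q) :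
    bmoNorm p Q (fun t => -Real.log (t - sInf Q)) ≤ ENNReal.ofReal (logMoment p 1 ^ (1 / p)) := by
  have hp0 : 0 < p := by linarith
  have hL := logMoment_one_pos hp
  rw [bmoNorm]
  refine iSup_le fun a => iSup_le fun b => iSup_le fun hJ => ?_
  have hr : 0 < b - a := sub_pos.2 hJ.1
  have ha : 0 ≤ a - sInf Q := sub_nonneg.2 (le_of_isSubinterval_of_bddBelow hQ hJ)
  rw [← ENNReal.ofReal_rpow_of_nonneg hL.le (by positivity)]
  refine ENNReal.rpow_le_rpow ?_ (by positivity)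
  have hav := average_comp_affine a hr one_pos fun t => -Real.log (t - sInf Q)
  have hlav := laverage_comp_affine a hr 0 1 fun t => ENNReal.ofReal
    (|-Real.log (t - sInf Q) - ⨍ s in Ioo a b, -Real.log (s - sInf Q)| ^ p)
  simp only [mul_zero, add_zero, mul_one, add_sub_cancel] at hav hlav
  rw [← hlav, ← hav, average_Ioo_zero_one, intervalIntegral.integral_neg,
    laverage_Ioo_le_iff one_pos, sub_zero, ENNReal.ofReal_one, mul_one]
  refine le_trans (le_of_eq ?_) (lintegral_log_affine_osc_le hp ha hr)
  refine lintegral_congr fun s => ?_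
  rw [← abs_neg]
  simp only [add_sub_right_comm]
  congr 3
  ring

theorem locIntegrable_neg_log_sub (Q : Set ℝ) (α : ℝ) :
    LocIntegrable Q fun t => -Real.log (t - α) := by
  intro a b hJ
  rw [← intervalIntegrable_iff_integrableOn_Ioo_of_le hJ.1.le]
  have := (intervalIntegral.intervalIntegrable_log' (a := a - α) (b := b - α)).comp_sub_right α
  rw [sub_add_cancel, sub_add_cancel] at this
  exact this.neg

/-- Local integrability alone decides: the weight is `(t - inf Q) ^ (-ε)`, which is integrable at
the left end only for `ε < 1`. -/
theorem epsSup_neg_log_le_one {Q : Set ℝ} (hQ : Q.OrdConnected) (hQn : Q.Nontrivial)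
    (hQb : BddBelow Q) : epsSup Q (fun t => -Real.log (t - sInf Q)) ≤ 1 := by
  refine iSup_le fun ε => iSup_le fun hε => iSup_le fun h => ?_
  obtain ⟨x, hx, y, hy, hxy⟩ := hQn.exists_lt
  have hαy : sInf Q < y := (csInf_le hQb hx).trans_lt hxy
  have hJ : IsSubinterval Q (sInf Q) y := by
    refine ⟨hαy, fun z hz => ?_⟩
    obtain ⟨w, hw, hwz⟩ := exists_lt_of_csInf_lt ⟨x, hx⟩ hz.1
    exact hQ.out hw hy ⟨hwz.le, hz.2.le⟩
  have h1 := h.2.1 _ _ hJ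
  have h2 := integrableOn_comp_affine (sInf Q) one_pos (c := 0) (d := y - sInf Q)
    (f := fun t => Real.exp (ε * -Real.log (t - sInf Q))) (by simpa using h1)
  have h3 : IntegrableOn (fun s : ℝ => s ^ (-ε)) (Ioo 0 (y - sInf Q)) := by
    refine h2.congr_fun (fun s hs => ?_) measurableSet_Ioo
    simp only [one_mul, add_sub_cancel_left]
    rw [Real.rpow_def_of_pos hs.1]
    congr 1
    ring
  rw [intervalIntegral.integrableOn_Ioo_rpow_iff (sub_pos.2 hαy)] at h3
  exact ENNReal.ofReal_le_one.2 (by linarith)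

theorem sharp_neg_log {p : ℝ} (hp : 1 ≤ p) {Q : Set ℝ} (hQ : Q.OrdConnected)
    (hQn : Q.Nontrivial) (hQb : Bornology.IsBounded Q) :
    ∃ φ : ℝ → ℝ, MemBMO p Q φ ∧
      0 < min (epsSup Q φ) (epsSup Q (fun t => -φ t)) ∧
      min (epsSup Q φ) (epsSup Q (fun t => -φ t)) < ∞ ∧
      bmoDistLInfty p Q φ =
        johnNirenbergConst p / min (epsSup Q φ) (epsSup Q (fun t => -φ t)) := by
  have hbelow := hQb.bddBelow
  set φ : ℝ → ℝ := fun t => -Real.log (t - sInf Q) with hφ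
  have hloc : LocIntegrable Q φ := locIntegrable_neg_log_sub Q (sInf Q)
  have hE := Real.rpow_pos_of_pos (logMoment_one_pos hp) (1 / p)
  have hnorm : bmoNorm p Q φ ≤ ENNReal.ofReal (logMoment p 1 ^ (1 / p)) :=
    bmoNorm_neg_log_le hp hbelow
  have hJN : ENNReal.ofReal (logMoment p 1 ^ (1 / p)) ≤ johnNirenbergConst p :=
    le_sSup (johnNirenbergBelow_logMoment hp)
  have hmin : min (epsSup Q φ) (epsSup Q (fun t => -φ t)) ≤ 1 :=
    (min_le_left _ _).trans (epsSup_neg_log_le_one hQ hQn hbelow)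
  refine ⟨φ, ⟨hloc, hnorm.trans_lt ENNReal.ofReal_lt_top⟩, ?_, hmin.trans_lt ENNReal.one_lt_top, ?_⟩
  -- Any exponent below 1 keeps the scaled norm strictly under the threshold; one half suffices for
  -- positivity.
  · have := le_min_epsSup hp hloc (f := fun _ => 0) (MemLp.zero' (p := ∞)) one_half_pos (by
      simp only [sub_zero]
      refine lt_of_lt_of_le ?_ hJN
      refine (mul_le_mul_right hnorm _).trans_lt ?_
      rw [← ENNReal.ofReal_mul (by norm_num), ENNReal.ofReal_lt_ofReal_iff hE]
      linarith)
    exact (ENNReal.ofReal_pos.2 one_half_pos).trans_le this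
  · refine le_antisymm ?_ (div_min_epsSup_le_bmoDistLInfty hp hloc)
    calc bmoDistLInfty p Q φ ≤ bmoNorm p Q φ := by
          unfold bmoDistLInfty
          refine iInf_le_of_le (fun _ => 0) (iInf_le_of_le (MemLp.zero' (p := ∞)) ?_)
          simp only [sub_zero, le_refl]
      _ ≤ johnNirenbergConst p := hnorm.trans hJN
      _ = johnNirenbergConst p / 1 := (div_one _).symm
      _ ≤ _ := ENNReal.div_le_div_left hmin _

theorem mainTheorem8 (p : ℝ) (hp : p ∈ Set.Icc (1 : ℝ) 2) :
    (∀ Q : Set ℝ, Q.OrdConnected → Q.Nontrivial → Bornology.IsBounded Q →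
      ∀ φ : ℝ → ℝ, MemBMO p Q φ →
        johnNirenbergConst p / min (epsSup Q φ) (epsSup Q (fun t => -φ t)) ≤
          bmoDistLInfty p Q φ) ∧
    (∀ φ : ℝ → ℝ, MemBMO p Set.univ φ →
      johnNirenbergConst p / min (epsSup Set.univ φ) (epsSup Set.univ (fun t => -φ t)) ≤
        bmoDistLInfty p Set.univ φ) ∧
    (∀ Q : Set ℝ, Q.OrdConnected → Q.Nontrivial → Bornology.IsBounded Q →
      ∃ φ : ℝ → ℝ, MemBMO p Q φ ∧
        0 < min (epsSup Q φ) (epsSup Q (fun t => -φ t)) ∧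
        min (epsSup Q φ) (epsSup Q (fun t => -φ t)) < ∞ ∧
        bmoDistLInfty p Q φ =
          johnNirenbergConst p / min (epsSup Q φ) (epsSup Q (fun t => -φ t))) :=
  ⟨fun _ _ _ _ _ hφ => div_min_epsSup_le_bmoDistLInfty hp.1 hφ.1,
    fun _ hφ => div_min_epsSup_le_bmoDistLInfty hp.1 hφ.1,
    fun _ hQ hQn hQb => sharp_neg_log hp.1 hQ hQn hQb⟩
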